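/- Let $g=\mathrm{diag}(1,-1,-1,-1)$ and $p\cdot x=g_{\mu\nu}p^\mu x^\nu$, $p^2=p\cdot p$. Let $D^+$ and $E^+$ be the inverse Fourier transforms $(2\pi)^{-4}\int(\cdot)\,e^{-ip\cdot x}\,dp$ of $\theta(p^0)\delta(p^2)$ and $\theta(p^0)\delta'(p^2)$ on $\mathbb R^4$ (only second derivatives of $E^+$ are used, so that no extension of $\delta'(p^2)$ to $p=0$ has to be chosen). Let $\lambda,\rho\in\mathbb R$ with $\lambda\neq 1$, let $\kappa=\frac{\lambda}{1-\lambda}$ or $\kappa=-\frac{\lambda}{1-\lambda}$, and assume $\kappa\ne 1$. Let $A_\mu$ be the free (quasi-free) Hermitean vector potential with two-point function $$\langle\Omega,A_\nu(x)A_\mu(y)\Omega\rangle=(-g_{\mu\nu}+\rho\,\partial_\mu\partial_\nu)D^+(x-y)+\kappa\,\partial_\mu\partial_\nu E^+(x-y),$$ i.e. the field obtained from the Wightman functional $\underline W$ defined by Wick's theorem on the Borchers algebra $\underline{\mathcal S}$ (the tensor algebra over $\mathcal S(\mathbb R^4,\mathbb C^4)$) through the GNS construction: it acts by left multiplication on $\mathcal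 D=\underline{\mathcal S}/\{f:\underline W(h^*\otimes f)=0\ \forall h\}$, with inner product $\langle[f],[h]\rangle=\underline W(f^*\otimes h)$ and vacuum $\Omega=[\mathbf 1]$. Put $F_{\nu\mu}=\partial_\mu A_\nu-\partial_\nu A_\mu$ and $B=\partial_\mu A^\mu$, let $B^+$ be the positive frequency (annihilation) part of $B$, and $$\mathcal H'=\{\Psi\in\mathcal D: B^+(x)\Psi=0\},\qquad \mathcal H''=\{\Psi\in\mathcal H':\langle\Psi,\Psi\rangle=0\}$$ (all fields are operator-valued distributions on $\mathcal D$, smeared with complex Schwartz functions). Then: 0. $B^+$ is the positive frequency part of $B$: with $\hat h(p)=\int h(x)e^{ip\cdot x}dx$, one has $B^+(h)=B(h)$ if $\hat h$ vanishes on the forward light cone $\{p^2=0,\,p^0\ge0\}$, and $B^+(h)=0$ if $\hat h$ vanishes on the backward light cone $\{p^2=0,\,p^0\le0\}$; 1. $\Omega\in\mathcal H'$; 2. the observable fields $F_{\nu\mu}$ map $\mathcal H'$ to itself; 3. $\langle\cdot,\cdot\rangle$ is positive semidefinite on $\mathcal H'$; 4. the observable fields $F_{\nu\mu}$ map $\mathcal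 H''$ to itself; 5. the (free) Maxwell equations hold on $\mathcal H'$: $\langle\Psi,\partial^\nu F_{\nu\mu}(x)\Phi\rangle=0$ for all $\Psi,\Phi\in\mathcal H'$ and all $\mu$. -/

import Mathlib

set_option linter.unusedSimpArgs false

noncomputable section

namespace QuasiFree

/-- One-particle data of a Hermitean quasi-free field: a complex vector space `M` of test functions
with a complex conjugation and a Hermitean two-point function `w f g = ⟨Ω, φ(f) φ(g) Ω⟩`. -/
structure Data (M : Type*) [AddCommGroup M] [Module ℂ M] where
  conj : M →ₛₗ[starRingEnd ℂ] M
  conj_conj : ∀ f, conj (conj f) = f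
  w : M →ₗ[ℂ] M →ₗ[ℂ] ℂ
  w_conj : ∀ f g, w (conj g) (conj f) = starRingEnd ℂ (w f g)

variable {M : Type*} [AddCommGroup M] [Module ℂ M]

/-! ### Contractions: the derivations of the tensor and symmetric algebras extending `g ↦ ℓ g • 1` -/

/-- Auxiliary map `g ↦ (g, ℓ g • 1)` into the dual numbers over the tensor algebra. -/
def contractGen (ℓ : M →ₗ[ℂ] ℂ) :
    M →ₗ[ℂ] TrivSqZeroExt (TensorAlgebra ℂ M) (TensorAlgebra ℂ M) where
  toFun g := TrivSqZeroExt.inl (TensorAlgebra.ι ℂ g) +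
    TrivSqZeroExt.inr (ℓ g • (1 : TensorAlgebra ℂ M))
  map_add' g h := by ext <;> simp [add_smul]
  map_smul' c g := by ext <;> simp [mul_smul]

/-- The derivation of the tensor algebra that sends a generator `g` to the scalar `ℓ g`:
`f₁ ⊗ ⋯ ⊗ fₙ ↦ ∑ k, ℓ fₖ • (f₁ ⊗ ⋯ ⊗ fₙ` without the factor `fₖ)`. -/
def contract (ℓ : M →ₗ[ℂ] ℂ) : TensorAlgebra ℂ M →ₗ[ℂ] TensorAlgebra ℂ M where
  toFun a := (TensorAlgebra.lift ℂ (contractGen ℓ) a).snd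
  map_add' a b := by simp
  map_smul' c a := by simp

/-- Auxiliary map `g ↦ (g, ℓ g • 1)` into the dual numbers over the symmetric algebra. -/
def contractSymGen (ℓ : M →ₗ[ℂ] ℂ) :
    M →ₗ[ℂ] TrivSqZeroExt (SymmetricAlgebra ℂ M) (SymmetricAlgebra ℂ M) where
  toFun g := TrivSqZeroExt.inl (SymmetricAlgebra.ι ℂ M g) +
    TrivSqZeroExt.inr (ℓ g • (1 : SymmetricAlgebra ℂ M))
  map_add' g h := by ext <;> simp [add_smul]
  map_smul' c g := by ext <;> simp [mul_smul]

/-- The derivation of the symmetric algebra that sends a generator `g` to the scalar `ℓ g`. -/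
def contractSym (ℓ : M →ₗ[ℂ] ℂ) : SymmetricAlgebra ℂ M →ₗ[ℂ] SymmetricAlgebra ℂ M where
  toFun a := (SymmetricAlgebra.lift (contractSymGen ℓ) a).snd
  map_add' a b := by simp
  map_smul' c a := by simp

theorem lift_contractGen_fst (ℓ : M →ₗ[ℂ] ℂ) (a : TensorAlgebra ℂ M) :
    (TensorAlgebra.lift ℂ (contractGen ℓ) a).fst = a := by
  have : (TrivSqZeroExt.fstHom ℂ (TensorAlgebra ℂ M) (TensorAlgebra ℂ M)).comp
      (TensorAlgebra.lift ℂ (contractGen ℓ)) = AlgHom.id ℂ _ := by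
    ext g; simp [contractGen]
  exact DFunLike.congr_fun this a

theorem contract_one (ℓ : M →ₗ[ℂ] ℂ) : contract ℓ 1 = 0 := by simp [contract]

theorem contract_algebraMap (ℓ : M →ₗ[ℂ] ℂ) (c : ℂ) :
    contract ℓ (algebraMap ℂ _ c) = 0 := by
  rw [Algebra.algebraMap_eq_smul_one, map_smul, contract_one, smul_zero]

theorem contract_ι (ℓ : M →ₗ[ℂ] ℂ) (g : M) :
    contract ℓ (TensorAlgebra.ι ℂ g) = algebraMap ℂ _ (ℓ g) := by
  simp [contract, contractGen, Algebra.algebraMap_eq_smul_one]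

theorem contract_mul (ℓ : M →ₗ[ℂ] ℂ) (a b : TensorAlgebra ℂ M) :
    contract ℓ (a * b) = a * contract ℓ b + contract ℓ a * b := by
  simp [contract, lift_contractGen_fst]

theorem lift_contractSymGen_fst (ℓ : M →ₗ[ℂ] ℂ) (a : SymmetricAlgebra ℂ M) :
    (SymmetricAlgebra.lift (contractSymGen ℓ) a).fst = a := by
  have : (TrivSqZeroExt.fstHom ℂ (SymmetricAlgebra ℂ M) (SymmetricAlgebra ℂ M)).comp
      (SymmetricAlgebra.lift (contractSymGen ℓ)) = AlgHom.id ℂ _ := by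
    apply SymmetricAlgebra.algHom_ext
    ext g; simp [contractSymGen]
  exact DFunLike.congr_fun this a

theorem contractSym_one (ℓ : M →ₗ[ℂ] ℂ) : contractSym ℓ 1 = 0 := by simp [contractSym]

theorem contractSym_algebraMap (ℓ : M →ₗ[ℂ] ℂ) (c : ℂ) :
    contractSym ℓ (algebraMap ℂ _ c) = 0 := by
  rw [Algebra.algebraMap_eq_smul_one, map_smul, contractSym_one, smul_zero]

theorem contractSym_ι (ℓ : M →ₗ[ℂ] ℂ) (g : M) :
    contractSym ℓ (SymmetricAlgebra.ι ℂ M g) = algebraMap ℂ _ (ℓ g) := by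
  simp [contractSym, contractSymGen, Algebra.algebraMap_eq_smul_one]

theorem contractSym_mul (ℓ : M →ₗ[ℂ] ℂ) (a b : SymmetricAlgebra ℂ M) :
    contractSym ℓ (a * b) = a * contractSym ℓ b + contractSym ℓ a * b := by
  simp [contractSym, lift_contractSymGen_fst, mul_comm]

theorem contractSym_comm (ℓ k : M →ₗ[ℂ] ℂ) (a : SymmetricAlgebra ℂ M) :
    contractSym ℓ (contractSym k a) = contractSym k (contractSym ℓ a) := by
  induction a using SymmetricAlgebra.induction with
  | algebraMap r => simp [contractSym_algebraMap]
  | ι x => simp [contractSym_ι, contractSym_algebraMap]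
  | mul a b ha hb => simp only [contractSym_mul, map_add, ha, hb]; ring
  | add a b ha hb => simp only [map_add, ha, hb]

theorem contractSym_add (ℓ k : M →ₗ[ℂ] ℂ) (a : SymmetricAlgebra ℂ M) :
    contractSym (ℓ + k) a = contractSym ℓ a + contractSym k a := by
  induction a using SymmetricAlgebra.induction with
  | algebraMap r => simp [contractSym_algebraMap]
  | ι x => simp [contractSym_ι]
  | mul a b ha hb => simp only [contractSym_mul, ha, hb]; ring
  | add a b ha hb => simp only [map_add, ha, hb]; ring

theorem contractSym_smul (c : ℂ) (ℓ : M →ₗ[ℂ] ℂ) (a : SymmetricAlgebra ℂ M) :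
    contractSym (c • ℓ) a = c • contractSym ℓ a := by
  induction a using SymmetricAlgebra.induction with
  | algebraMap r => simp [contractSym_algebraMap]
  | ι x => simp [contractSym_ι, Algebra.smul_def]
  | mul a b ha hb => simp only [contractSym_mul, ha, hb]; simp [Algebra.smul_def]; ring
  | add a b ha hb => simp only [map_add, ha, hb]; simp

theorem contract_add (ℓ k : M →ₗ[ℂ] ℂ) (a : TensorAlgebra ℂ M) :
    contract (ℓ + k) a = contract ℓ a + contract k a := by
  induction a using TensorAlgebra.induction with
  | algebraMap r => simp [contract_algebraMap]
  | ι x => simp [contract_ι]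
  | mul a b ha hb => simp only [contract_mul, ha, hb, mul_add, add_mul]; abel
  | add a b ha hb => simp only [map_add, ha, hb]; abel

theorem contract_smul (c : ℂ) (ℓ : M →ₗ[ℂ] ℂ) (a : TensorAlgebra ℂ M) :
    contract (c • ℓ) a = c • contract ℓ a := by
  induction a using TensorAlgebra.induction with
  | algebraMap r => simp [contract_algebraMap]
  | ι x => simp [contract_ι, Algebra.smul_def]
  | mul a b ha hb => simp only [contract_mul, ha, hb]; simp
  | add a b ha hb => simp only [map_add, ha, hb]; simp

/-! ### The Wightman functional of a quasi-free field (Wick's theorem) -/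

/-- The field operator `a†(f) + a(f)` on the symmetric (Fock) algebra: multiplication by `f` plus
the contraction with `w f`. -/
def fockField (q : Data M) : M →ₗ[ℂ] Module.End ℂ (SymmetricAlgebra ℂ M) where
  toFun f := LinearMap.mulLeft ℂ (SymmetricAlgebra.ι ℂ M f) + contractSym (q.w f)
  map_add' f g := by
    ext a; simp [contractSym_add, add_mul]; abel
  map_smul' c f := by
    ext a; simp [contractSym_smul]

theorem fockField_apply (q : Data M) (f : M) (t : SymmetricAlgebra ℂ M) :
    fockField q f t = SymmetricAlgebra.ι ℂ M f * t + contractSym (q.w f) t := rfl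

/-- The Wightman functional `f₁ ⊗ ⋯ ⊗ fₙ ↦ ⟨Ω, φ(f₁) ⋯ φ(fₙ) Ω⟩` on the Borchers algebra: the
vacuum component of the product of field operators applied to the Fock vacuum, that is, the sum over
all pairings of products of two-point functions (see `wightman_one` and `wightman_ι_mul` for
the recursive form of Wick's theorem). -/
def wightman (q : Data M) : TensorAlgebra ℂ M →ₗ[ℂ] ℂ :=
  (SymmetricAlgebra.algebraMapInv (R := ℂ) (M := M)).toLinearMap ∘ₗ
    LinearMap.applyₗ (1 : SymmetricAlgebra ℂ M) ∘ₗ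
      (TensorAlgebra.lift ℂ (fockField q)).toLinearMap

theorem wightman_apply (q : Data M) (a : TensorAlgebra ℂ M) :
    wightman q a = SymmetricAlgebra.algebraMapInv (TensorAlgebra.lift ℂ (fockField q) a 1) := rfl

theorem wightman_one (q : Data M) : wightman q 1 = 1 := by simp [wightman_apply]

theorem contractSym_lift (q : Data M) (ℓ : M →ₗ[ℂ] ℂ) (a : TensorAlgebra ℂ M)
    (t : SymmetricAlgebra ℂ M) :
    contractSym ℓ (TensorAlgebra.lift ℂ (fockField q) a t) =
      TensorAlgebra.lift ℂ (fockField q) a (contractSym ℓ t) +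
      TensorAlgebra.lift ℂ (fockField q) (contract ℓ a) t := by
  induction a using TensorAlgebra.induction generalizing t with
  | algebraMap r => simp [contract_algebraMap, Module.algebraMap_end_apply]
  | ι x =>
    simp [contract_ι, fockField, contractSym_mul, contractSym_ι, contractSym_comm ℓ,
      Module.algebraMap_end_apply, Algebra.smul_def]
    abel
  | mul a b ha hb => simp [contract_mul, ha, hb]; abel
  | add a b ha hb => simp [ha, hb]; abel

theorem lift_mul_ι (q : Data M) (f : M) (c : TensorAlgebra ℂ M) (t : SymmetricAlgebra ℂ M) :
    TensorAlgebra.lift ℂ (fockField q) c (SymmetricAlgebra.ι ℂ M f * t) =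
      SymmetricAlgebra.ι ℂ M f * TensorAlgebra.lift ℂ (fockField q) c t +
      TensorAlgebra.lift ℂ (fockField q) (contract (q.w.flip f) c) t := by
  induction c using TensorAlgebra.induction generalizing t with
  | algebraMap r => simp [contract_algebraMap, Module.algebraMap_end_apply]
  | ι x =>
    simp [contract_ι, fockField, contractSym_mul, contractSym_ι,
      Module.algebraMap_end_apply, Algebra.smul_def]
    ring
  | mul a b ha hb => simp [contract_mul, ha, hb]; abel
  | add a b ha hb => simp [ha, hb, mul_add]; abel

/-- A field operator inside a vacuum expectation value is contracted with all the factors to its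
right and with all the factors to its left. -/
theorem wightman_mul_ι_mul (q : Data M) (c : TensorAlgebra ℂ M) (f : M) (a : TensorAlgebra ℂ M) :
    wightman q (c * (TensorAlgebra.ι ℂ f * a)) =
      wightman q (c * contract (q.w f) a) + wightman q (contract (q.w.flip f) c * a) := by
  have h := contractSym_lift q (q.w f) a 1
  rw [contractSym_one, map_zero, zero_add] at h
  simp only [wightman_apply, map_mul, TensorAlgebra.lift_ι_apply, Module.End.mul_apply,
    fockField_apply, map_add, lift_mul_ι, h]
  rw [add_comm]
  congr 1
  rw [SymmetricAlgebra.algebraMapInv_ι, zero_mul, zero_add]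

/-- Wick's theorem in recursive form. -/
theorem wightman_ι_mul (q : Data M) (f : M) (a : TensorAlgebra ℂ M) :
    wightman q (TensorAlgebra.ι ℂ f * a) = wightman q (contract (q.w f) a) := by
  have h := wightman_mul_ι_mul q 1 f a
  simpa [contract_one] using h

theorem wightman_mul_ι (q : Data M) (c : TensorAlgebra ℂ M) (f : M) :
    wightman q (c * TensorAlgebra.ι ℂ f) = wightman q (contract (q.w.flip f) c) := by
  have h := wightman_mul_ι_mul q c f 1
  simpa [contract_one] using h

/-! ### The involution of the Borchers algebra -/

/-- The opposite of the tensor algebra, on which the complex numbers act through complex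
conjugation. -/
def ConjOp (M : Type*) [AddCommGroup M] [Module ℂ M] : Type _ := (TensorAlgebra ℂ M)ᵐᵒᵖ

instance : Ring (ConjOp M) := inferInstanceAs (Ring (TensorAlgebra ℂ M)ᵐᵒᵖ)

instance : Algebra ℂ (ConjOp M) :=
  Algebra.compHom (TensorAlgebra ℂ M)ᵐᵒᵖ (starRingEnd ℂ)

/-- The map `f ↦ f*` on generators, as a complex linear map to `ConjOp M`. -/
def adjGen (q : Data M) : M →ₗ[ℂ] ConjOp M where
  toFun f := MulOpposite.op (TensorAlgebra.ι ℂ (q.conj f))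
  map_add' f g := by rw [map_add, map_add, MulOpposite.op_add]; rfl
  map_smul' c f := by rw [LinearMap.map_smulₛₗ, map_smul, MulOpposite.op_smul]; rfl

/-- The involution as a ring homomorphism to the opposite algebra. -/
def adjOp (q : Data M) : TensorAlgebra ℂ M →+* (TensorAlgebra ℂ M)ᵐᵒᵖ :=
  (TensorAlgebra.lift ℂ (adjGen q) : TensorAlgebra ℂ M →+* ConjOp M)

theorem adjOp_ι (q : Data M) (f : M) :
    adjOp q (TensorAlgebra.ι ℂ f) = MulOpposite.op (TensorAlgebra.ι ℂ (q.conj f)) :=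
  TensorAlgebra.lift_ι_apply (adjGen q) f

theorem adjOp_algebraMap (q : Data M) (c : ℂ) :
    adjOp q (algebraMap ℂ _ c) = MulOpposite.op (algebraMap ℂ _ (starRingEnd ℂ c)) :=
  AlgHom.commutes (TensorAlgebra.lift ℂ (adjGen q)) c

/-- The involution `(f₁ ⊗ ⋯ ⊗ fₙ)* = fₙ* ⊗ ⋯ ⊗ f₁*` of the Borchers algebra. -/
def adj (q : Data M) : TensorAlgebra ℂ M →ₛₗ[starRingEnd ℂ] TensorAlgebra ℂ M where
  toFun a := (adjOp q a).unop
  map_add' a b := by simp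
  map_smul' c a := by
    rw [Algebra.smul_def, map_mul, adjOp_algebraMap, MulOpposite.unop_mul, MulOpposite.unop_op,
      Algebra.smul_def, Algebra.commutes]

theorem adj_ι (q : Data M) (f : M) :
    adj q (TensorAlgebra.ι ℂ f) = TensorAlgebra.ι ℂ (q.conj f) :=
  congrArg MulOpposite.unop (adjOp_ι q f)

theorem adj_algebraMap (q : Data M) (c : ℂ) :
    adj q (algebraMap ℂ _ c) = algebraMap ℂ _ (starRingEnd ℂ c) :=
  congrArg MulOpposite.unop (adjOp_algebraMap q c)

theorem adj_one (q : Data M) : adj q 1 = 1 := by simp [adj]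

theorem adj_mul (q : Data M) (a b : TensorAlgebra ℂ M) : adj q (a * b) = adj q b * adj q a := by
  simp [adj]

theorem adj_adj (q : Data M) (a : TensorAlgebra ℂ M) : adj q (adj q a) = a := by
  induction a using TensorAlgebra.induction with
  | algebraMap r => simp [adj_algebraMap]
  | ι x => simp [adj_ι, q.conj_conj]
  | mul a b ha hb => simp [adj_mul, ha, hb]
  | add a b ha hb => simp [ha, hb]

theorem adj_contract (q : Data M) (f : M) (a : TensorAlgebra ℂ M) :
    adj q (contract (q.w f) a) = contract (q.w.flip (q.conj f)) (adj q a) := by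
  induction a using TensorAlgebra.induction with
  | algebraMap r => simp [adj_algebraMap, contract_algebraMap]
  | ι x => simp [adj_ι, adj_algebraMap, contract_ι, q.w_conj]
  | mul a b ha hb => simp [adj_mul, contract_mul, ha, hb]; abel
  | add a b ha hb => simp [ha, hb]

/-- The span of the words of length `n`. -/
def words (M : Type*) [AddCommGroup M] [Module ℂ M] (n : ℕ) : Submodule ℂ (TensorAlgebra ℂ M) :=
  Submodule.span ℂ {a | ∃ l : List M, l.length = n ∧ a = (l.map (TensorAlgebra.ι ℂ)).prod}

theorem ι_mul_mem_words (f : M) {n : ℕ} {a : TensorAlgebra ℂ M} (ha : a ∈ words M n) :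
    TensorAlgebra.ι ℂ f * a ∈ words M (n + 1) := by
  induction ha using Submodule.span_induction with
  | mem x hx =>
    obtain ⟨l, hl, rfl⟩ := hx
    exact Submodule.subset_span ⟨f :: l, by simp [hl], by simp⟩
  | zero => simp
  | add x y _ _ hx hy => rw [mul_add]; exact add_mem hx hy
  | smul c x _ hx => rw [mul_smul_comm]; exact Submodule.smul_mem _ _ hx

theorem contract_mem_words (ℓ : M →ₗ[ℂ] ℂ) (l : List M) :
    ∀ n, l.length = n + 1 → contract ℓ (l.map (TensorAlgebra.ι ℂ)).prod ∈ words M n := by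
  induction l with
  | nil => simp
  | cons g l ih =>
    intro n hn
    simp only [List.length_cons, Nat.add_right_cancel_iff] at hn
    simp only [List.map_cons, List.prod_cons, contract_mul, contract_ι, ← Algebra.smul_def]
    refine add_mem ?_ (Submodule.smul_mem _ _ (Submodule.subset_span ⟨l, hn, rfl⟩))
    cases n with
    | zero =>
      rw [List.length_eq_zero_iff] at hn
      subst hn
      simp [contract_one]
    | succ m => exact ι_mul_mem_words g (ih m hn)

theorem mem_span_words (a : TensorAlgebra ℂ M) :
    a ∈ Submodule.span ℂ {a | ∃ l : List M, a = (l.map (TensorAlgebra.ι ℂ)).prod} := by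
  induction a using TensorAlgebra.induction with
  | algebraMap r =>
    rw [Algebra.algebraMap_eq_smul_one]
    exact Submodule.smul_mem _ _ (Submodule.subset_span ⟨[], by simp⟩)
  | ι x => exact Submodule.subset_span ⟨[x], by simp⟩
  | mul a b ha hb =>
    have := Submodule.mul_mem_mul ha hb
    rw [Submodule.span_mul_span] at this
    refine Submodule.span_mono ?_ this
    rintro _ ⟨_, ⟨l, rfl⟩, _, ⟨m, rfl⟩, rfl⟩
    exact ⟨l ++ m, by simp⟩
  | add a b ha hb => exact add_mem ha hb

theorem wightman_adj (q : Data M) (a : TensorAlgebra ℂ M) :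
    wightman q (adj q a) = starRingEnd ℂ (wightman q a) := by
  have key : ∀ n, ∀ a ∈ words M n, wightman q (adj q a) = starRingEnd ℂ (wightman q a) := by
    intro n
    induction n using Nat.strong_induction_on with
    | _ n ih =>
      intro a ha
      induction ha using Submodule.span_induction with
      | mem x hx =>
        obtain ⟨l, hl, rfl⟩ := hx
        cases l with
        | nil => simp [adj_one, wightman_one]
        | cons f l =>
          simp only [List.map_cons, List.prod_cons, adj_mul, adj_ι, wightman_mul_ι,
            wightman_ι_mul, ← adj_contract]
          cases l with
          | nil => simp [contract_one]
          | cons g l =>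
            refine ih l.length (by simp only [List.length_cons] at hl; omega) _
              (contract_mem_words _ _ _ (by simp))
      | zero => simp
      | add x y _ _ hx hy => simp [hx, hy]
      | smul c x _ hx => simp [hx]
  induction mem_span_words a using Submodule.span_induction with
  | mem x hx =>
    obtain ⟨l, rfl⟩ := hx
    exact key l.length _ (Submodule.subset_span ⟨l, rfl, rfl⟩)
  | zero => simp
  | add x y _ _ hx hy => simp [hx, hy]
  | smul c x _ hx => simp [hx]

/-! ### The GNS space -/

/-- The left kernel `{a | W(h* ⊗ a) = 0 for all h}` of the Wightman functional. -/
def leftKernel (q : Data M) : Submodule ℂ (TensorAlgebra ℂ M) where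
  carrier := {a | ∀ h, wightman q (adj q h * a) = 0}
  add_mem' ha hb h := by rw [mul_add, map_add, ha h, hb h, add_zero]
  zero_mem' h := by simp
  smul_mem' c a ha h := by rw [mul_smul_comm, map_smul, ha h, smul_zero]

theorem mem_leftKernel {q : Data M} {a : TensorAlgebra ℂ M} :
    a ∈ leftKernel q ↔ ∀ h, wightman q (adj q h * a) = 0 := Iff.rfl

theorem mem_leftKernel' {q : Data M} {a : TensorAlgebra ℂ M} :
    a ∈ leftKernel q ↔ ∀ h, wightman q (h * a) = 0 :=
  ⟨fun ha h => by simpa [adj_adj] using ha (adj q h), fun ha h => ha _⟩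

/-- The GNS space: the Borchers algebra modulo the left kernel of the Wightman functional. It is the
domain spanned by the vectors `φ(f₁) ⋯ φ(fₙ) Ω`. -/
abbrev GNS (q : Data M) : Type _ := TensorAlgebra ℂ M ⧸ leftKernel q

/-- The GNS vacuum `Ω`, the class of the unit. -/
def vacuum (q : Data M) : GNS q := (leftKernel q).mkQ 1

/-- The (indefinite) inner product of the GNS space, `⟨[a], [b]⟩ = W(a* ⊗ b)`, antilinear in the
first argument. -/
def innerProd (q : Data M) : GNS q →ₛₗ[starRingEnd ℂ] GNS q →ₗ[ℂ] ℂ :=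
  (leftKernel q).liftQ
    { toFun := fun a => (leftKernel q).liftQ (wightman q ∘ₗ LinearMap.mulLeft ℂ (adj q a))
        (fun _ hb => hb a)
      map_add' := fun a b => by
        refine LinearMap.ext fun x => ?_
        obtain ⟨x, rfl⟩ := (leftKernel q).mkQ_surjective x
        change wightman q (adj q (a + b) * x) = wightman q (adj q a * x) + wightman q (adj q b * x)
        rw [map_add, add_mul, map_add]
      map_smul' := fun c a => by
        refine LinearMap.ext fun x => ?_
        obtain ⟨x, rfl⟩ := (leftKernel q).mkQ_surjective x
        change wightman q (adj q (c • a) * x) = starRingEnd ℂ c * wightman q (adj q a * x)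
        rw [LinearMap.map_smulₛₗ, smul_mul_assoc, map_smul, smul_eq_mul] }
    (fun a ha => by
      refine LinearMap.ext fun b => ?_
      obtain ⟨b, rfl⟩ := (leftKernel q).mkQ_surjective b
      have h := wightman_adj q (adj q b * a)
      rw [ha b, map_zero, adj_mul, adj_adj] at h
      exact h)

theorem innerProd_mk (q : Data M) (a b : TensorAlgebra ℂ M) :
    innerProd q ((leftKernel q).mkQ a) ((leftKernel q).mkQ b) = wightman q (adj q a * b) := rfl

theorem ι_mul_mem_leftKernel (q : Data M) (f : M) {a : TensorAlgebra ℂ M}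
    (ha : a ∈ leftKernel q) : TensorAlgebra.ι ℂ f * a ∈ leftKernel q := by
  rw [mem_leftKernel'] at ha ⊢
  intro h
  rw [← mul_assoc]
  exact ha _

theorem contract_mem_leftKernel (q : Data M) (f : M) {a : TensorAlgebra ℂ M}
    (ha : a ∈ leftKernel q) : contract (q.w f) a ∈ leftKernel q := by
  rw [mem_leftKernel'] at ha ⊢
  intro h
  have h1 := wightman_mul_ι_mul q h f a
  rw [← mul_assoc, ha, ha, add_zero] at h1
  exact h1.symm

/-- The field operator `φ(f)` on the GNS space: left multiplication by `f`. -/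
def field (q : Data M) (f : M) : Module.End ℂ (GNS q) :=
  (leftKernel q).mapQ (leftKernel q) (LinearMap.mulLeft ℂ (TensorAlgebra.ι ℂ f))
    (fun _ ha => Submodule.mem_comap.2 (ι_mul_mem_leftKernel q f ha))

/-- The annihilation (positive frequency) part of the field operator `φ(f)`:
`φ⁺(f) φ(f₁) ⋯ φ(fₙ) Ω = ∑ k, w f fₖ • φ(f₁) ⋯ φ(fₙ) Ω` with the factor `φ(fₖ)` omitted. -/
def annihilator (q : Data M) (f : M) : Module.End ℂ (GNS q) :=
  (leftKernel q).mapQ (leftKernel q) (contract (q.w f))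
    (fun _ ha => Submodule.mem_comap.2 (contract_mem_leftKernel q f ha))

end QuasiFree

namespace GuptaBleuler

open MeasureTheory SchwartzMap
open scoped LineDeriv FourierTransform


/-- Minkowski space-time `ℝ⁴` (as a set of points; the Euclidean structure is used only for the
Lebesgue measure and for the Schwartz space). -/
abbrev Spacetime : Type := EuclideanSpace ℝ (Fin 4)

/-- Complex Schwartz functions on space-time. -/
abbrev Scalar : Type := 𝓢(Spacetime, ℂ)

/-- Test functions `f = (f^μ)` for the vector potential, `A(f) = ∫ A_μ(x) f^μ(x) dx`. -/
abbrev VectorTest : Type := Fin 4 → Scalar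

/-- The Minkowski metric `g = diag(1, -1, -1, -1)` (the inverse metric has the same entries). -/
def metric (μ ν : Fin 4) : ℝ := if μ = ν then (if μ = 0 then 1 else -1) else 0

/-- Lowering of an index, `p_μ = g_{μν} p^ν`. -/
def lower (p : Spacetime) (μ : Fin 4) : ℝ := ∑ ν, metric μ ν * p ν

/-- The Minkowski inner product `p · x = g_{μν} p^μ x^ν`. -/
def mdot (p x : Spacetime) : ℝ := ∑ μ, lower p μ * x μ

/-- The partial derivative `∂_μ`. -/
def pd (μ : Fin 4) (h : Scalar) : Scalar := ∂_{EuclideanSpace.single μ (1 : ℝ)} h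

/-- The derivative with raised index, `∂^μ = g^{μν} ∂_ν`. -/
def pdUp (μ : Fin 4) (h : Scalar) : Scalar := ∑ ν, (metric μ ν : ℂ) • pd ν h

/-- The Fourier transform `ĥ(p) = ∫ h(x) e^{i p·x} dx` for the Minkowski inner product. -/
def ft (h : Scalar) (p : Spacetime) : ℂ :=
  ∫ x, Complex.exp (Complex.I * (mdot p x : ℂ)) * h x

/-- The momentum `(√s, k)`. -/
def shell (k : EuclideanSpace ℝ (Fin 3)) (s : ℝ) : Spacetime := !₂[√s, k 0, k 1, k 2]

/-- The density of `H` over the positive energies in the variable `s = (p⁰)²`: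
`∫ θ(p⁰) φ((p⁰)²) H(p⁰, k) dp⁰ = ∫_{s > 0} φ(s) H(√s, k) / (2 √s) ds`. -/
def energyDensity (H : Spacetime → ℂ) (k : EuclideanSpace ℝ (Fin 3)) (s : ℝ) : ℂ :=
  H (shell k s) / (2 * (√s : ℂ))

/-- The distribution `θ(p⁰) δ(p²)`, with `p² = (p⁰)² - |k|²` for `p = (p⁰, k)`. -/
def deltaPlus (H : Spacetime → ℂ) : ℂ :=
  ∫ k : EuclideanSpace ℝ (Fin 3), energyDensity H k (‖k‖ ^ 2)

/-- The distribution `θ(p⁰) δ'(p²)`. The integral converges when `H` is a Schwartz function that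
vanishes at the origin to first order; here it is used for second derivatives of test functions,
where `H` carries the factor `p_μ p_ν`, so that no extension to the origin has to be chosen. -/
def deltaPrimePlus (H : Spacetime → ℂ) : ℂ :=
  -∫ k : EuclideanSpace ℝ (Fin 3), deriv (energyDensity H k) (‖k‖ ^ 2)

/-- `∫∫ f(x) D⁺(x - y) g(y) dx dy`, where
`D⁺(x) = (2π)⁻⁴ ∫ θ(p⁰) δ(p²) e^{-i p·x} dp` is the inverse Fourier transform of `θ(p⁰) δ(p²)`. -/
def Dplus (f g : Scalar) : ℂ := ((2 * Real.pi) ^ 4 : ℂ)⁻¹ * deltaPlus (fun p => ft f (-p) * ft g p)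

/-- `∫∫ f(x) E⁺(x - y) g(y) dx dy`, where `E⁺` is the inverse Fourier transform of
`θ(p⁰) δ'(p²)`. -/
def Eplus (f g : Scalar) : ℂ :=
  ((2 * Real.pi) ^ 4 : ℂ)⁻¹ * deltaPrimePlus (fun p => ft f (-p) * ft g p)

/-- The smeared two-point function `∫∫ ⟨Ω, A_ν(x) A_μ(y) Ω⟩ f^ν(x) g^μ(y) dx dy` with
`⟨Ω, A_ν(x) A_μ(y) Ω⟩ = (-g_{μν} + ρ ∂_μ ∂_ν) D⁺(x - y) + κ ∂_μ ∂_ν E⁺(x - y)`; the derivatives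
act in the sense of distributions. -/
def twoPoint (κ ρ : ℝ) (f g : VectorTest) : ℂ :=
  ∑ μ, ∑ ν, (-(metric μ ν : ℂ) * Dplus (f ν) (g μ) + (ρ : ℂ) * Dplus (pd μ (pd ν (f ν))) (g μ) +
    (κ : ℂ) * Eplus (pd μ (pd ν (f ν))) (g μ))

/-- The complex conjugate of a Schwartz function. -/
def conjScalar (h : Scalar) : Scalar :=
  postcompCLM (𝕜 := ℝ) (Complex.conjCLE : ℂ →L[ℝ] ℂ) h

theorem conjScalar_apply (h : Scalar) (x : Spacetime) :
    conjScalar h x = starRingEnd ℂ (h x) := rfl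

/-! ### The two-point function is bilinear and Hermitean -/

theorem pd_add (μ : Fin 4) (f g : Scalar) : pd μ (f + g) = pd μ f + pd μ g :=
  LineDeriv.lineDerivOp_add _ _ _

theorem pd_smul (μ : Fin 4) (c : ℂ) (f : Scalar) : pd μ (c • f) = c • pd μ f :=
  LineDeriv.lineDerivOp_smul _ _ _

/-- The map `p ↦ -(2π)⁻¹ (p_μ)`, which relates `ft` to the Fourier transform of Mathlib. -/
def dualMap : Spacetime ≃L[ℝ] Spacetime :=
  LinearEquiv.toContinuousLinearEquiv
    { toFun := fun p => WithLp.toLp 2 fun μ => -(2 * Real.pi)⁻¹ * lower p μ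
      invFun := fun p => WithLp.toLp 2 fun μ => -(2 * Real.pi) * lower p μ
      map_add' := fun p q => by
        ext μ; simp [lower, mul_add, Finset.sum_add_distrib]
      map_smul' := fun c p => by
        ext μ; simp [lower, Finset.mul_sum, mul_left_comm]
      left_inv := fun p => by
        have := Real.pi_ne_zero
        ext μ
        fin_cases μ <;> simp [lower, metric, Fin.sum_univ_four] <;> field_simp
      right_inv := fun p => by
        have := Real.pi_ne_zero
        ext μ
        fin_cases μ <;> simp [lower, metric, Fin.sum_univ_four] <;> field_simp }

theorem dualMap_apply (p : Spacetime) (μ : Fin 4) :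
    dualMap p μ = -(2 * Real.pi)⁻¹ * lower p μ := rfl

theorem lower_neg (p : Spacetime) (μ : Fin 4) : lower (-p) μ = -lower p μ := by
  simp [lower]

theorem ft_eq (h : Scalar) (p : Spacetime) : ft h p = 𝓕 h (dualMap p) := by
  rw [fourier_coe, Real.fourier_eq']
  unfold ft
  congr 1
  ext x
  rw [smul_eq_mul]
  congr 2
  have : (-2 * Real.pi * inner ℝ x (dualMap p)) = mdot p x := by
    have := Real.pi_ne_zero
    simp only [PiLp.inner_apply, dualMap_apply, mdot, Finset.mul_sum]
    refine Finset.sum_congr rfl fun μ _ => ?_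
    simp
    field_simp
  rw [this]; ring

theorem ft_pd (μ : Fin 4) (h : Scalar) (p : Spacetime) :
    ft (pd μ h) p = -Complex.I * (lower p μ : ℂ) * ft h p := by
  rw [ft_eq, ft_eq, pd, fourier_lineDerivOp_eq]
  have hg : (fun x : Spacetime => inner ℝ x (EuclideanSpace.single μ (1 : ℝ))).HasTemperateGrowth :=
    ((innerSL ℝ).flip _).hasTemperateGrowth
  have := Complex.ofReal_ne_zero.2 Real.pi_ne_zero
  rw [smul_apply, smulLeftCLM_apply_apply hg]
  simp [EuclideanSpace.inner_single_right, dualMap_apply]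
  field_simp

theorem ft_conj (h : Scalar) (p : Spacetime) :
    ft (conjScalar h) p = starRingEnd ℂ (ft h (-p)) := by
  unfold ft
  rw [← integral_conj]
  congr 1
  ext x
  rw [map_mul, ← Complex.exp_conj, conjScalar_apply]
  congr 2
  simp [mdot, lower_neg]

/-- The Schwartz function `p ↦ f̂(-p) ĝ(p)`. -/
def spec (f g : Scalar) : Scalar :=
  pairing (ContinuousLinearMap.mul ℂ ℂ)
    (compCLMOfContinuousLinearEquiv ℂ (dualMap.trans (ContinuousLinearEquiv.neg ℝ)) (𝓕 f))
    (compCLMOfContinuousLinearEquiv ℂ dualMap (𝓕 g))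

theorem spec_apply (f g : Scalar) (p : Spacetime) : spec f g p = ft f (-p) * ft g p := by
  rw [ft_eq, ft_eq]; simp [spec]

theorem spec_pd (μ ν : Fin 4) (f g : Scalar) (p : Spacetime) :
    spec (pd μ (pd ν f)) g p = -((lower p μ : ℂ) * (lower p ν : ℂ)) * spec f g p := by
  rw [spec_apply, spec_apply, ft_pd, ft_pd, lower_neg, lower_neg]
  push_cast
  linear_combination (lower p μ * lower p ν * ft f (-p) * ft g p : ℂ) * Complex.I_sq

theorem spec_conj (f g : Scalar) : spec (conjScalar g) (conjScalar f) = conjScalar (spec f g) := by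
  ext p
  simp only [spec_apply, ft_conj, neg_neg, conjScalar_apply, map_mul, mul_comm]

theorem integrable_aux :
    Integrable (fun k : EuclideanSpace ℝ (Fin 3) => (1 + ‖k‖) ^ (-4 : ℝ) * ‖k‖⁻¹) := by
  have h := integrable_fun_norm_addHaar (volume : Measure (EuclideanSpace ℝ (Fin 3)))
    (f := fun y : ℝ => (1 + y) ^ (-4 : ℝ) * y⁻¹)
  rw [h]
  have h1 : Integrable (fun y : ℝ => (1 + ‖y‖) ^ (-3 : ℝ)) :=
    integrable_one_add_norm (by simp)
  refine h1.integrableOn.mono' ?_ ?_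
  · refine Measurable.aestronglyMeasurable ?_
    fun_prop
  · refine (ae_restrict_iff' measurableSet_Ioi).2 (Filter.Eventually.of_forall fun y hy => ?_)
    have hy : 0 < y := hy
    simp only [finrank_euclideanSpace, Fintype.card_fin, smul_eq_mul, Real.norm_eq_abs,
      abs_of_pos hy]
    rw [abs_of_pos (by positivity)]
    have : (1 + y) ^ (-4 : ℝ) = (1 + y) ^ (-3 : ℝ) * (1 + y)⁻¹ := by
      rw [← Real.rpow_neg_one, ← Real.rpow_add (by positivity)]; norm_num
    rw [this]
    have h2 : y ^ (3 - 1) * ((1 + y) ^ (-3 : ℝ) * (1 + y)⁻¹ * y⁻¹) =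
        (1 + y) ^ (-3 : ℝ) * (y / (1 + y)) := by
      field_simp
    rw [h2]
    refine mul_le_of_le_one_right (by positivity) ?_
    rw [div_le_one (by positivity)]
    linarith

theorem shell_norm_sq (k : EuclideanSpace ℝ (Fin 3)) :
    shell k (‖k‖ ^ 2) = !₂[‖k‖, k 0, k 1, k 2] := by
  simp [shell, Real.sqrt_sq]

theorem norm_le_norm_shell (k : EuclideanSpace ℝ (Fin 3)) (s : ℝ) : ‖k‖ ≤ ‖shell k s‖ := by
  rw [EuclideanSpace.norm_eq, EuclideanSpace.norm_eq]
  refine Real.sqrt_le_sqrt ?_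
  simp [Fin.sum_univ_four, Fin.sum_univ_three, shell]

theorem abs_lower_shell (k : EuclideanSpace ℝ (Fin 3)) (μ : Fin 4) :
    |lower (shell k (‖k‖ ^ 2)) μ| ≤ ‖k‖ := by
  have h : ∀ i, |k i| ≤ ‖k‖ := fun i => PiLp.norm_apply_le k i
  rw [shell_norm_sq]
  fin_cases μ <;> simp [lower, metric, h]

theorem exists_bound (Q : Scalar) :
    ∃ C : ℝ, ∀ k s, ‖Q (shell k s)‖ ≤ C * (1 + ‖k‖) ^ (-4 : ℝ) := by
  refine ⟨2 ^ 4 * ((Finset.Iic (4, 0)).sup fun m => SchwartzMap.seminorm ℂ m.1 m.2) Q,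
    fun k s => ?_⟩
  have h := one_add_le_sup_seminorm_apply (𝕜 := ℂ) (m := (4, 0)) le_rfl le_rfl Q (shell k s)
  rw [norm_iteratedFDeriv_zero] at h
  have h2 : (1 + ‖k‖) ^ 4 * ‖Q (shell k s)‖ ≤ _ := le_trans (by
    have := norm_le_norm_shell k s
    gcongr) h
  rw [Real.rpow_neg (by positivity), ← div_eq_mul_inv, le_div_iff₀ (by positivity), mul_comm]
  exact_mod_cast h2

theorem measurable_shell : Measurable fun k : EuclideanSpace ℝ (Fin 3) => shell k (‖k‖ ^ 2) := by
  unfold shell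
  fun_prop

theorem integrable_energyDensity (Q : Scalar) :
    Integrable (fun k : EuclideanSpace ℝ (Fin 3) => energyDensity Q k (‖k‖ ^ 2)) := by
  obtain ⟨C, hC⟩ := exists_bound Q
  refine (integrable_aux.const_mul C).mono' ?_ (Filter.Eventually.of_forall fun k => ?_)
  · have h1 : Measurable fun k : EuclideanSpace ℝ (Fin 3) => Q (shell k (‖k‖ ^ 2)) :=
      Q.continuous.measurable.comp measurable_shell
    refine Measurable.aestronglyMeasurable ?_
    exact h1.div (by fun_prop)
  · have h := hC k (‖k‖ ^ 2)
    simp only [energyDensity, norm_div, norm_mul, Complex.norm_real, Real.sqrt_sq (norm_nonneg k),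
      norm_norm]
    rw [← mul_assoc, ← div_eq_mul_inv]
    have h0 : ‖(2 : ℂ)‖ = 2 := by simp
    rw [h0, div_mul_eq_div_div]
    have : ‖Q (shell k (‖k‖ ^ 2))‖ / 2 ≤ C * (1 + ‖k‖) ^ (-4 : ℝ) := by
      linarith [norm_nonneg (Q (shell k (‖k‖ ^ 2)))]
    gcongr

/-- The integrand of `deltaPrimePlus` for `p ↦ p_μ p_ν Q(p)`, computed. -/
def derivFormula (μ ν : Fin 4) (Q : Scalar) (k : EuclideanSpace ℝ (Fin 3)) : ℂ :=
  let p := shell k (‖k‖ ^ 2)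
  let r : ℂ := (‖k‖ : ℂ)
  ((((metric μ 0 : ℂ) / (2 * r)) * lower p ν + lower p μ * ((metric ν 0 : ℂ) / (2 * r))) * Q p +
    lower p μ * lower p ν * (pd 0 Q p / (2 * r))) / (2 * r) -
  lower p μ * lower p ν * Q p / (4 * r ^ 3)

theorem hasDerivAt_coord {f : ℝ → Spacetime} {f' : Spacetime} {s : ℝ} :
    HasDerivAt f f' s ↔ ∀ i, HasDerivAt (fun t => f t i) (f' i) s := by
  rw [hasDerivAt_iff_hasFDerivAt, ← hasFDerivWithinAt_univ, hasFDerivWithinAt_euclidean]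
  refine forall_congr' fun i => ?_
  rw [hasDerivAt_iff_hasFDerivAt, ← hasFDerivWithinAt_univ]
  refine iff_of_eq ?_
  congr 1

theorem hasDerivAt_shell (k : EuclideanSpace ℝ (Fin 3)) (hk : k ≠ 0) :
    HasDerivAt (shell k) ((2 * ‖k‖)⁻¹ • EuclideanSpace.single 0 (1 : ℝ)) (‖k‖ ^ 2) := by
  have hk' : ‖k‖ ≠ 0 := norm_ne_zero_iff.2 hk
  have h := (hasDerivAt_id (‖k‖ ^ 2)).sqrt (pow_ne_zero 2 hk')
  rw [hasDerivAt_coord]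
  intro i
  fin_cases i
  · simpa [shell, Real.sqrt_sq] using h
  · simpa [shell] using hasDerivAt_const (‖k‖ ^ 2) (k 0)
  · simpa [shell] using hasDerivAt_const (‖k‖ ^ 2) (k 1)
  · simpa [shell] using hasDerivAt_const (‖k‖ ^ 2) (k 2)

theorem hasDerivAt_lower_shell (k : EuclideanSpace ℝ (Fin 3)) (hk : k ≠ 0) (μ : Fin 4) :
    HasDerivAt (fun s => (lower (shell k s) μ : ℂ)) ((metric μ 0 : ℂ) / (2 * (‖k‖ : ℂ)))
      (‖k‖ ^ 2) := by
  have h := hasDerivAt_shell k hk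
  rw [hasDerivAt_coord] at h
  have h2 : HasDerivAt (fun s => lower (shell k s) μ) (metric μ 0 / (2 * ‖k‖)) (‖k‖ ^ 2) := by
    unfold lower
    refine (HasDerivAt.fun_sum fun ν _ => (h ν).const_mul (metric μ ν)).congr_deriv ?_
    simp [Fin.sum_univ_four, div_eq_mul_inv]
  exact_mod_cast h2.ofReal_comp

theorem hasDerivAt_energyDensity (μ ν : Fin 4) (Q : Scalar) (k : EuclideanSpace ℝ (Fin 3))
    (hk : k ≠ 0) :
    HasDerivAt (energyDensity (fun p => (lower p μ : ℂ) * (lower p ν : ℂ) * Q p) k)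
      (derivFormula μ ν Q k) (‖k‖ ^ 2) := by
  have hk' : ‖k‖ ≠ 0 := norm_ne_zero_iff.2 hk
  have hkc : (‖k‖ : ℂ) ≠ 0 := Complex.ofReal_ne_zero.2 hk'
  have hQ : HasDerivAt (fun s => Q (shell k s)) (pd 0 Q (shell k (‖k‖ ^ 2)) / (2 * (‖k‖ : ℂ)))
      (‖k‖ ^ 2) := by
    refine ((Q.hasFDerivAt _).comp_hasDerivAt _ (hasDerivAt_shell k hk)).congr_deriv ?_
    rw [map_smul, pd, lineDerivOp_apply_eq_fderiv, Complex.real_smul]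
    push_cast
    field_simp
  have hs : HasDerivAt (fun s : ℝ => 2 * (√s : ℂ)) (1 / (‖k‖ : ℂ)) (‖k‖ ^ 2) := by
    have h := (((hasDerivAt_id (‖k‖ ^ 2)).sqrt (pow_ne_zero 2 hk')).ofReal_comp).const_mul (2 : ℂ)
    refine h.congr_deriv ?_
    simp [Real.sqrt_sq]
    ring
  have h := (((hasDerivAt_lower_shell k hk μ).mul (hasDerivAt_lower_shell k hk ν)).mul hQ).div hs
    (by simp [Real.sqrt_sq, hk'])
  refine h.congr_deriv ?_
  simp only [derivFormula, Pi.mul_apply, Real.sqrt_sq (norm_nonneg k)]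
  field_simp
  ring

theorem abs_metric_le (μ ν : Fin 4) : |metric μ ν| ≤ 1 := by
  unfold metric; split_ifs <;> simp

theorem norm_derivFormula_le (μ ν : Fin 4) (Q : Scalar) (k : EuclideanSpace ℝ (Fin 3)) :
    ‖derivFormula μ ν Q k‖ ≤ ‖Q (shell k (‖k‖ ^ 2))‖ * ‖k‖⁻¹ + ‖pd 0 Q (shell k (‖k‖ ^ 2))‖ := by
  by_cases hk : k = 0
  · subst hk; simp [derivFormula]
  have hk' : 0 < ‖k‖ := norm_pos_iff.2 hk
  unfold derivFormula
  set p := shell k (‖k‖ ^ 2)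
  have hμ : ‖(lower p μ : ℂ)‖ ≤ ‖k‖ := by simpa using abs_lower_shell k μ
  have hν : ‖(lower p ν : ℂ)‖ ≤ ‖k‖ := by simpa using abs_lower_shell k ν
  have gμ : ‖(metric μ 0 : ℂ)‖ ≤ 1 := by simpa using abs_metric_le μ 0
  have gν : ‖(metric ν 0 : ℂ)‖ ≤ 1 := by simpa using abs_metric_le ν 0
  refine (norm_sub_le _ _).trans ?_
  rw [norm_div]
  have h1 := norm_add_le ((((metric μ 0 : ℂ) / (2 * ‖k‖)) * lower p ν +
    lower p μ * ((metric ν 0 : ℂ) / (2 * ‖k‖))) * Q p)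
    (lower p μ * lower p ν * (pd 0 Q p / (2 * ‖k‖)))
  have h2 := norm_add_le (((metric μ 0 : ℂ) / (2 * ‖k‖)) * lower p ν)
    (lower p μ * ((metric ν 0 : ℂ) / (2 * ‖k‖)))
  simp only [norm_mul, norm_div, norm_pow, Complex.norm_real, norm_norm, Complex.norm_ofNat]
    at h1 h2 hμ hν gμ gν ⊢
  set a := ‖lower p μ‖
  set b := ‖lower p ν‖
  set Q0 := ‖Q p‖
  set Q1 := ‖pd 0 Q p‖
  set r := ‖k‖
  set g1 := ‖metric μ 0‖
  set g2 := ‖metric ν 0‖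
  have e1 : g1 / (2 * r) * b ≤ 1 / (2 * r) * r := by gcongr
  have e2 : a * (g2 / (2 * r)) ≤ r * (1 / (2 * r)) := by gcongr
  have e3 : a * b * (Q1 / (2 * r)) ≤ r * r * (Q1 / (2 * r)) := by gcongr
  have e4 : a * b * Q0 / (4 * r ^ 3) ≤ r * r * Q0 / (4 * r ^ 3) := by gcongr
  have f1 : 1 / (2 * r) * r = 1 / 2 := by field_simp
  have f2 : r * (1 / (2 * r)) = 1 / 2 := by field_simp
  have f3 : r * r * (Q1 / (2 * r)) = r * Q1 / 2 := by field_simp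
  have f4 : r * r * Q0 / (4 * r ^ 3) = Q0 * r⁻¹ / 4 := by field_simp
  have h3 : ‖(metric μ 0 : ℂ) / (2 * ‖k‖) * lower p ν +
      lower p μ * ((metric ν 0 : ℂ) / (2 * ‖k‖))‖ * Q0 ≤ 1 * Q0 := by
    refine mul_le_mul_of_nonneg_right ?_ (norm_nonneg _)
    linarith
  refine (add_le_add (div_le_div_of_nonneg_right (h1.trans (add_le_add h3 (e3.trans_eq f3)))
    (by positivity)) (e4.trans_eq f4)).trans ?_
  have f5 : (1 * Q0 + r * Q1 / 2) / (2 * r) = Q0 * r⁻¹ / 2 + Q1 / 4 := by field_simp; ring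
  rw [f5]
  have : 0 ≤ Q0 * r⁻¹ := by positivity
  have : 0 ≤ Q1 := norm_nonneg _
  linarith

theorem measurable_derivFormula (μ ν : Fin 4) (Q : Scalar) :
    Measurable (derivFormula μ ν Q) := by
  have h1 : Measurable fun k : EuclideanSpace ℝ (Fin 3) => Q (shell k (‖k‖ ^ 2)) :=
    Q.continuous.measurable.comp measurable_shell
  have h2 : Measurable fun k : EuclideanSpace ℝ (Fin 3) => pd 0 Q (shell k (‖k‖ ^ 2)) :=
    (pd 0 Q).continuous.measurable.comp measurable_shell
  have h3 : ∀ μ, Measurable fun k : EuclideanSpace ℝ (Fin 3) =>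
      (lower (shell k (‖k‖ ^ 2)) μ : ℂ) := by
    intro μ
    refine Complex.measurable_ofReal.comp (Measurable.comp (g := fun p => lower p μ) ?_
      measurable_shell)
    unfold lower
    fun_prop
  have h4 := h3 μ
  have h5 := h3 ν
  have h6 : Measurable fun k : EuclideanSpace ℝ (Fin 3) => (‖k‖ : ℂ) := by fun_prop
  have h7 : Measurable fun k : EuclideanSpace ℝ (Fin 3) => 2 * (‖k‖ : ℂ) := h6.const_mul 2
  exact ((((((measurable_const.div h7).mul h5).add (h4.mul (measurable_const.div h7))).mul h1).add
    ((h4.mul h5).mul (h2.div h7))).div h7).sub (((h4.mul h5).mul h1).div ((h6.pow_const 3).const_mul 4))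

theorem integrable_derivFormula (μ ν : Fin 4) (Q : Scalar) : Integrable (derivFormula μ ν Q) := by
  obtain ⟨C, hC⟩ := exists_bound Q
  obtain ⟨C', hC'⟩ := exists_bound (pd 0 Q)
  have h4 : Integrable fun k : EuclideanSpace ℝ (Fin 3) => (1 + ‖k‖) ^ (-4 : ℝ) :=
    integrable_one_add_norm (by simp; norm_num)
  refine ((integrable_aux.const_mul C).add (h4.const_mul C')).mono'
    (measurable_derivFormula μ ν Q).aestronglyMeasurable (Filter.Eventually.of_forall fun k => ?_)
  refine (norm_derivFormula_le μ ν Q k).trans ?_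
  simp only [Pi.add_apply, ← mul_assoc]
  have := hC k (‖k‖ ^ 2)
  have := hC' k (‖k‖ ^ 2)
  gcongr

theorem deltaPrimePlus_eq (μ ν : Fin 4) (Q : Scalar) :
    deltaPrimePlus (fun p => (lower p μ : ℂ) * (lower p ν : ℂ) * Q p) =
      -∫ k, derivFormula μ ν Q k := by
  unfold deltaPrimePlus
  congr 1
  refine integral_congr_ae ?_
  have h : ∀ᵐ k : EuclideanSpace ℝ (Fin 3), k ≠ 0 := by
    simp [ae_iff]
  filter_upwards [h] with k hk
  exact (hasDerivAt_energyDensity μ ν Q k hk).deriv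

/-- `Q ↦ ∫ θ(p⁰) δ(p²) Q(p) dp` as a linear functional. -/
def deltaLin : Scalar →ₗ[ℂ] ℂ where
  toFun Q := deltaPlus Q
  map_add' Q R := by
    unfold deltaPlus
    rw [← integral_add (integrable_energyDensity Q) (integrable_energyDensity R)]
    congr 1; ext k; simp [energyDensity, add_div]
  map_smul' c Q := by
    unfold deltaPlus
    rw [RingHom.id_apply, smul_eq_mul, ← integral_const_mul]
    congr 1; ext k; simp [energyDensity, mul_div_assoc]

/-- `Q ↦ ∫ θ(p⁰) δ'(p²) p_μ p_ν Q(p) dp` as a linear functional. -/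
def deltaPrimeLin (μ ν : Fin 4) : Scalar →ₗ[ℂ] ℂ where
  toFun Q := deltaPrimePlus (fun p => (lower p μ : ℂ) * (lower p ν : ℂ) * Q p)
  map_add' Q R := by
    simp only [deltaPrimePlus_eq]
    rw [← neg_add, ← integral_add (integrable_derivFormula μ ν Q) (integrable_derivFormula μ ν R)]
    congr 2; ext k; simp only [derivFormula, pd_add, add_apply]; ring
  map_smul' c Q := by
    simp only [deltaPrimePlus_eq]
    rw [RingHom.id_apply, smul_eq_mul, mul_neg, ← integral_const_mul]
    congr 2; ext k; simp only [derivFormula, pd_smul, smul_apply, smul_eq_mul]; ring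

theorem deltaLin_conj (Q : Scalar) : deltaLin (conjScalar Q) = starRingEnd ℂ (deltaLin Q) := by
  change deltaPlus _ = starRingEnd ℂ (deltaPlus _)
  unfold deltaPlus
  rw [← integral_conj]
  congr 1; ext k
  simp [energyDensity, conjScalar_apply, Complex.conj_ofNat]

theorem pd_conj (μ : Fin 4) (Q : Scalar) : pd μ (conjScalar Q) = conjScalar (pd μ Q) := by
  ext x
  rw [conjScalar_apply, pd, pd, lineDerivOp_apply_eq_fderiv, lineDerivOp_apply_eq_fderiv]
  have h : HasFDerivAt (conjScalar Q) ((Complex.conjCLE : ℂ →L[ℝ] ℂ).comp (fderiv ℝ Q x)) x :=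
    (Complex.conjCLE : ℂ →L[ℝ] ℂ).hasFDerivAt.comp x (Q.hasFDerivAt x)
  rw [h.fderiv]
  rfl

theorem deltaPrimeLin_conj (μ ν : Fin 4) (Q : Scalar) :
    deltaPrimeLin μ ν (conjScalar Q) = starRingEnd ℂ (deltaPrimeLin μ ν Q) := by
  change deltaPrimePlus _ = starRingEnd ℂ (deltaPrimePlus _)
  rw [deltaPrimePlus_eq, deltaPrimePlus_eq, map_neg, ← integral_conj]
  congr 2; ext k
  simp [derivFormula, pd_conj, conjScalar_apply, Complex.conj_ofNat]

theorem deltaPrimeLin_comm (μ ν : Fin 4) : deltaPrimeLin μ ν = deltaPrimeLin ν μ := by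
  ext Q
  change deltaPrimePlus _ = deltaPrimePlus _
  congr 1; ext p; ring

theorem metric_comm (μ ν : Fin 4) : metric μ ν = metric ν μ := by
  unfold metric; split_ifs <;> simp_all

theorem spec_add_left (f f' g : Scalar) : spec (f + f') g = spec f g + spec f' g := by
  ext p; simp [spec, FourierAdd.fourier_add]

theorem spec_smul_left (c : ℂ) (f g : Scalar) : spec (c • f) g = c • spec f g := by
  ext p; simp [spec, FourierSMul.fourier_smul]

theorem spec_add_right (f g g' : Scalar) : spec f (g + g') = spec f g + spec f g' := by
  ext p; simp [spec, FourierAdd.fourier_add]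

theorem spec_smul_right (c : ℂ) (f g : Scalar) : spec f (c • g) = c • spec f g := by
  ext p; simp [spec, FourierSMul.fourier_smul]

theorem Dplus_eq (f g : Scalar) :
    Dplus f g = ((2 * Real.pi) ^ 4 : ℂ)⁻¹ * deltaLin (spec f g) := by
  unfold Dplus
  congr 2
  ext p
  exact (spec_apply f g p).symm

theorem Eplus_pd_eq (μ ν : Fin 4) (f g : Scalar) :
    Eplus (pd μ (pd ν f)) g =
      ((2 * Real.pi) ^ 4 : ℂ)⁻¹ * deltaPrimeLin μ ν (-spec f g) := by
  unfold Eplus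
  congr 2
  ext p
  rw [← spec_apply, spec_pd, neg_apply]
  ring

theorem spec_pd_comm (μ ν : Fin 4) (f g : Scalar) :
    spec (pd μ (pd ν f)) g = spec (pd ν (pd μ f)) g := by
  ext p; rw [spec_pd, spec_pd, mul_comm (lower p μ : ℂ)]

theorem spec_pd_conj (μ ν : Fin 4) (f g : Scalar) :
    spec (pd μ (pd ν (conjScalar g))) (conjScalar f) = conjScalar (spec (pd μ (pd ν f)) g) := by
  ext p; rw [spec_pd, spec_conj, conjScalar_apply, conjScalar_apply, spec_pd]; simp

/-- The two-point function as a bilinear form. -/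
def twoPointLin (κ ρ : ℝ) : VectorTest →ₗ[ℂ] VectorTest →ₗ[ℂ] ℂ :=
  LinearMap.mk₂ ℂ (twoPoint κ ρ)
    (fun f f' g => by
      simp only [twoPoint, Dplus_eq, Eplus_pd_eq]
      simp only [Pi.add_apply, pd_add, pd_smul, spec_add_left, spec_smul_left, spec_add_right,
        spec_smul_right, map_add, map_neg, map_smul, smul_eq_mul, Finset.mul_sum,
        ← Finset.sum_add_distrib]
      refine Finset.sum_congr rfl fun μ _ => Finset.sum_congr rfl fun ν _ => by ring)
    (fun c f g => by
      simp only [twoPoint, Dplus_eq, Eplus_pd_eq]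
      simp only [Pi.smul_apply, pd_add, pd_smul, spec_add_left, spec_smul_left, spec_add_right,
        spec_smul_right, map_add, map_neg, map_smul, smul_eq_mul, Finset.mul_sum,
        ← Finset.sum_add_distrib]
      refine Finset.sum_congr rfl fun μ _ => Finset.sum_congr rfl fun ν _ => by ring)
    (fun f g g' => by
      simp only [twoPoint, Dplus_eq, Eplus_pd_eq]
      simp only [Pi.add_apply, pd_add, pd_smul, spec_add_left, spec_smul_left, spec_add_right,
        spec_smul_right, map_add, map_neg, map_smul, smul_eq_mul, Finset.mul_sum,
        ← Finset.sum_add_distrib]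
      refine Finset.sum_congr rfl fun μ _ => Finset.sum_congr rfl fun ν _ => by ring)
    (fun c f g => by
      simp only [twoPoint, Dplus_eq, Eplus_pd_eq]
      simp only [Pi.smul_apply, pd_add, pd_smul, spec_add_left, spec_smul_left, spec_add_right,
        spec_smul_right, map_add, map_neg, map_smul, smul_eq_mul, Finset.mul_sum,
        ← Finset.sum_add_distrib]
      refine Finset.sum_congr rfl fun μ _ => Finset.sum_congr rfl fun ν _ => by ring)

/-- The complex conjugate of a test function; the vector potential is Hermitean. -/
def conjTest : VectorTest →ₛₗ[starRingEnd ℂ] VectorTest where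
  toFun f := fun μ => conjScalar (f μ)
  map_add' f g := by ext μ x; simp [conjScalar_apply]
  map_smul' c f := by ext μ x; simp [conjScalar_apply]

theorem conjTest_conjTest (f : VectorTest) : conjTest (conjTest f) = f := by
  ext μ x; simp [conjTest, conjScalar_apply]

theorem twoPoint_conj (κ ρ : ℝ) (f g : VectorTest) :
    twoPoint κ ρ (conjTest g) (conjTest f) = starRingEnd ℂ (twoPoint κ ρ f g) := by
  simp only [twoPoint, Dplus_eq, Eplus_pd_eq, conjTest, LinearMap.coe_mk, AddHom.coe_mk,
    spec_pd_conj, spec_conj, map_neg, map_sum, map_add, map_mul, deltaLin_conj,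
    deltaPrimeLin_conj, Complex.conj_ofReal, map_inv₀, map_pow, map_ofNat]
  rw [Finset.sum_comm]
  refine Finset.sum_congr rfl fun μ _ => Finset.sum_congr rfl fun ν _ => ?_
  rw [metric_comm ν μ, spec_pd_comm ν μ, deltaPrimeLin_comm ν μ]

/-! ### The free vector potential and the fields derived from it -/

/-- The one-particle data of the free vector potential. -/
def potentialData (κ ρ : ℝ) : QuasiFree.Data VectorTest where
  conj := conjTest
  conj_conj := conjTest_conjTest
  w := twoPointLin κ ρ
  w_conj := twoPoint_conj κ ρ

/-- The domain `𝒟`: the GNS space, spanned by the vectors `A(f₁) ⋯ A(fₙ) Ω`. -/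
abbrev Domain (κ ρ : ℝ) : Type := QuasiFree.GNS (potentialData κ ρ)

/-- The vacuum vector `Ω`. -/
def vacuum (κ ρ : ℝ) : Domain κ ρ := QuasiFree.vacuum (potentialData κ ρ)

/-- The indefinite inner product `⟨Ψ, Φ⟩`. -/
def innerProd (κ ρ : ℝ) (Ψ Φ : Domain κ ρ) : ℂ := QuasiFree.innerProd (potentialData κ ρ) Ψ Φ

/-- The vector potential `A_μ(h) = ∫ A_μ(x) h(x) dx`. -/
def potential (κ ρ : ℝ) (μ : Fin 4) (h : Scalar) : Module.End ℂ (Domain κ ρ) :=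
  QuasiFree.field (potentialData κ ρ) (Pi.single μ h)

/-- The positive frequency (annihilation) part `A_μ⁺(h)` of the vector potential. -/
def potentialPlus (κ ρ : ℝ) (μ : Fin 4) (h : Scalar) : Module.End ℂ (Domain κ ρ) :=
  QuasiFree.annihilator (potentialData κ ρ) (Pi.single μ h)

/-- The field strength `F_{νμ} = ∂_μ A_ν - ∂_ν A_μ`, smeared with `h`. -/
def fieldStrength (κ ρ : ℝ) (ν μ : Fin 4) (h : Scalar) : Module.End ℂ (Domain κ ρ) :=
  -potential κ ρ ν (pd μ h) - -potential κ ρ μ (pd ν h)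

/-- The divergence `∂^ν F_{νμ}` of the field strength, smeared with `h`. -/
def divFieldStrength (κ ρ : ℝ) (μ : Fin 4) (h : Scalar) : Module.End ℂ (Domain κ ρ) :=
  ∑ ν, -fieldStrength κ ρ ν μ (pdUp ν h)

/-- The field `B = ∂_μ A^μ = ∂^μ A_μ`, smeared with `h`. -/
def gaugeField (κ ρ : ℝ) (h : Scalar) : Module.End ℂ (Domain κ ρ) :=
  ∑ μ, -potential κ ρ μ (pdUp μ h)

/-- The positive frequency (annihilation) part `B⁺` of `B`, smeared with `h`. -/
def gaugeFieldPlus (κ ρ : ℝ) (h : Scalar) : Module.End ℂ (Domain κ ρ) :=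
  ∑ μ, -potentialPlus κ ρ μ (pdUp μ h)

/-- The space of physical states `𝓗' = {Ψ ∈ 𝒟 | B⁺(x) Ψ = 0}`. -/
def physical (κ ρ : ℝ) : Submodule ℂ (Domain κ ρ) :=
  ⨅ h : Scalar, LinearMap.ker (gaugeFieldPlus κ ρ h)

/-- The set `𝓗''` of null vectors of `𝓗'`. -/
def nullVectors (κ ρ : ℝ) : Set (Domain κ ρ) :=
  {Ψ | Ψ ∈ physical κ ρ ∧ innerProd κ ρ Ψ Ψ = 0}

end GuptaBleuler

end

open GuptaBleuler

noncomputable section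

namespace QuasiFree

variable {M : Type*} [AddCommGroup M] [Module ℂ M]

/-! ### Normal ordering -/

/-! The GNS space is a quotient of Fock space. Applying products of fields to the Fock vacuum maps
the Borchers algebra onto the symmetric algebra (`fockVector_surjective`), and the left kernel is
exactly the preimage of a subspace `fockRadical`. Dividing it out (`normalOrdered`) turns
multiplication by `f` into the creation part and `contractSym (q.w f)` into the annihilation part of
the field. These are adjoint to each other up to conjugation of `f`, and an annihilator commutes
with a field up to the scalar `q.w f g`. Every claim thus becomes a statement about the two-point
function.

In momentum space the central computation is `twoPoint_gaugeTest_left`. Contracting with `B`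
produces a factor `p²` in the gauge terms; since `p² δ(p²) = 0` and `p² δ'(p²) = -δ(p²)`, only `(κ -
1) δ(p²)` remains, paired with the divergence of the other test function. Three consequences follow.
The test functions of `F` are divergence-free, so `B⁺` commutes with `F` and physical states are
preserved. Since `κ ≠ 1`, a one-particle vector is killed by every `B⁺(h)` only if the divergence of
its test function vanishes almost everywhere on the forward cone. On the cone `∂^ν F_{νμ}` has
annihilation part `(1 - κ)⁻¹ ∂_μ B⁺`; hence it kills physical states from the right, and its
creation part does so from the left.

Positivity has a one-particle and a many-particle half. If `p · ĝ = 0` on the cone, the `ρ` term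
vanishes; the `κ` term vanishes too, because `|p · ĝ|²` has a minimum there and `δ'` sees only its
first derivative. The remaining `-g` term is nonnegative by Cauchy–Schwarz. To pass to many
particles, `exists_mem_generated_annihilated` shows that a vector killed by a family of annihilators
comes, modulo the radical, from the symmetric algebra over the one-particle vectors killed by the
family. After diagonalising a Gram matrix, monomials in orthogonal one-particle vectors are
orthogonal with nonnegative norms.

Stability of null vectors then follows from the Cauchy–Schwarz argument for the semidefinite form
together with hermiticity of `F`. -/

/-- The Fock representation of the Borchers algebra applied to the Fock vacuum. -/
def fockVector (q : Data M) : TensorAlgebra ℂ M →ₗ[ℂ] SymmetricAlgebra ℂ M :=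
  LinearMap.applyₗ (1 : SymmetricAlgebra ℂ M) ∘ₗ (TensorAlgebra.lift ℂ (fockField q)).toLinearMap

theorem fockVector_apply (q : Data M) (a : TensorAlgebra ℂ M) :
    fockVector q a = TensorAlgebra.lift ℂ (fockField q) a 1 := rfl

theorem fockVector_one (q : Data M) : fockVector q 1 = 1 := by simp [fockVector_apply]

theorem fockVector_mul (q : Data M) (a b : TensorAlgebra ℂ M) :
    fockVector q (a * b) = TensorAlgebra.lift ℂ (fockField q) a (fockVector q b) := by
  simp [fockVector_apply]

theorem contractSym_fockVector (q : Data M) (ℓ : M →ₗ[ℂ] ℂ) (a : TensorAlgebra ℂ M) :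
    contractSym ℓ (fockVector q a) = fockVector q (contract ℓ a) := by
  rw [fockVector_apply, contractSym_lift, contractSym_one, map_zero, zero_add, fockVector_apply]

theorem fockVector_ι_mul (q : Data M) (f : M) (a : TensorAlgebra ℂ M) :
    fockVector q (TensorAlgebra.ι ℂ f * a) =
      SymmetricAlgebra.ι ℂ M f * fockVector q a + contractSym (q.w f) (fockVector q a) := by
  rw [fockVector_mul, TensorAlgebra.lift_ι_apply, fockField_apply]

theorem wightman_eq_fockVector (q : Data M) (a : TensorAlgebra ℂ M) :
    wightman q a = SymmetricAlgebra.algebraMapInv (fockVector q a) := rfl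

/-- A subspace of the symmetric algebra that contains `1` and is stable under multiplication by
generators is everything. -/
theorem symmetricAlgebra_submodule_eq_top (P : Submodule ℂ (SymmetricAlgebra ℂ M)) (h1 : 1 ∈ P)
    (hι : ∀ f, ∀ s ∈ P, SymmetricAlgebra.ι ℂ M f * s ∈ P) : P = ⊤ := by
  have key : ∀ a : SymmetricAlgebra ℂ M, ∀ s ∈ P, a * s ∈ P := by
    intro a
    induction a using SymmetricAlgebra.induction with
    | algebraMap r => intro s hs; rw [← Algebra.smul_def]; exact P.smul_mem _ hs
    | ι x => exact hι x
    | mul a b ha hb => intro s hs; rw [mul_assoc]; exact ha _ (hb _ hs)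
    | add a b ha hb => intro s hs; rw [add_mul]; exact P.add_mem (ha _ hs) (hb _ hs)
  exact (Submodule.eq_top_iff'.2 fun a => by simpa using key a 1 h1)

theorem fockVector_surjective (q : Data M) : Function.Surjective (fockVector q) := by
  rw [← LinearMap.range_eq_top]
  refine symmetricAlgebra_submodule_eq_top _ ⟨1, fockVector_one q⟩ ?_
  rintro f _ ⟨a, rfl⟩
  -- Creation is field minus annihilation, and the annihilation part is itself realised on the
  -- tensor algebra by `contract`.
  refine ⟨TensorAlgebra.ι ℂ f * a - contract (q.w f) a, ?_⟩
  rw [map_sub, fockVector_ι_mul, contractSym_fockVector, add_sub_cancel_right]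

/-- The radical of the Fock space form: the image of the left kernel in the symmetric algebra. -/
def fockRadical (q : Data M) : Submodule ℂ (SymmetricAlgebra ℂ M) where
  carrier := {s | ∀ h : TensorAlgebra ℂ M,
    SymmetricAlgebra.algebraMapInv (TensorAlgebra.lift ℂ (fockField q) h s) = 0}
  add_mem' ha hb h := by rw [map_add, map_add, ha h, hb h, add_zero]
  zero_mem' h := by simp
  smul_mem' c a ha h := by rw [map_smul, map_smul, ha h, smul_zero]

theorem mem_fockRadical {q : Data M} {s : SymmetricAlgebra ℂ M} :
    s ∈ fockRadical q ↔ ∀ h : TensorAlgebra ℂ M,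
      SymmetricAlgebra.algebraMapInv (TensorAlgebra.lift ℂ (fockField q) h s) = 0 := Iff.rfl

theorem fockVector_mem_fockRadical {q : Data M} {a : TensorAlgebra ℂ M} :
    fockVector q a ∈ fockRadical q ↔ a ∈ leftKernel q := by
  rw [mem_fockRadical, mem_leftKernel']
  simp only [← fockVector_mul, wightman_eq_fockVector]

/-- Moving the creator leftwards through `h` leaves a contraction of `h`, while the term in which
the creator reaches the far left has no vacuum component. The radical is therefore stable under
creators, and since it is stable under fields also under annihilators; the reduction modulo the
radical needs both separately. -/
theorem ι_mul_mem_fockRadical (q : Data M) (f : M) {s : SymmetricAlgebra ℂ M}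
    (hs : s ∈ fockRadical q) : SymmetricAlgebra.ι ℂ M f * s ∈ fockRadical q := by
  intro h
  rw [lift_mul_ι, map_add, map_mul, SymmetricAlgebra.algebraMapInv_ι, zero_mul, zero_add]
  exact hs _

theorem contractSym_mem_fockRadical (q : Data M) (f : M) {s : SymmetricAlgebra ℂ M}
    (hs : s ∈ fockRadical q) : contractSym (q.w f) s ∈ fockRadical q := by
  have h : fockField q f s ∈ fockRadical q := by
    intro h
    have := hs (h * TensorAlgebra.ι ℂ f)
    rwa [map_mul, Module.End.mul_apply, TensorAlgebra.lift_ι_apply] at this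
  rw [fockField_apply] at h
  exact ((fockRadical q).add_mem_iff_right (ι_mul_mem_fockRadical q f hs)).1 h

/-- The normal ordered product: the vector `∏ φ⁻(fₖ) Ω` of creation operators applied to the
vacuum, as a map from the symmetric algebra onto the GNS space. -/
def normalOrdered (q : Data M) : SymmetricAlgebra ℂ M →ₗ[ℂ] GNS q :=
  (LinearMap.ker (fockVector q)).liftQ (leftKernel q).mkQ
    (fun a ha => by
      rw [LinearMap.mem_ker] at ha ⊢
      rw [Submodule.mkQ_apply, Submodule.Quotient.mk_eq_zero, ← fockVector_mem_fockRadical, ha]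
      exact zero_mem _) ∘ₗ
    ((fockVector q).quotKerEquivOfSurjective (fockVector_surjective q)).symm.toLinearMap

theorem normalOrdered_fockVector (q : Data M) (a : TensorAlgebra ℂ M) :
    normalOrdered q (fockVector q a) = (leftKernel q).mkQ a := by
  have h : ((fockVector q).quotKerEquivOfSurjective (fockVector_surjective q)).symm
      (fockVector q a) = (LinearMap.ker (fockVector q)).mkQ a := by
    rw [LinearEquiv.symm_apply_eq]; rfl
  rw [normalOrdered, LinearMap.comp_apply, LinearEquiv.coe_coe, h]
  rfl

theorem normalOrdered_surjective (q : Data M) : Function.Surjective (normalOrdered q) := by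
  intro Ψ
  obtain ⟨a, rfl⟩ := (leftKernel q).mkQ_surjective Ψ
  exact ⟨_, normalOrdered_fockVector q a⟩

theorem normalOrdered_eq_zero {q : Data M} {s : SymmetricAlgebra ℂ M} :
    normalOrdered q s = 0 ↔ s ∈ fockRadical q := by
  obtain ⟨a, rfl⟩ := fockVector_surjective q s
  rw [normalOrdered_fockVector, fockVector_mem_fockRadical, Submodule.mkQ_apply,
    Submodule.Quotient.mk_eq_zero]

/-! ### Fields, annihilators and the inner product -/

theorem field_mk (q : Data M) (f : M) (a : TensorAlgebra ℂ M) :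
    field q f ((leftKernel q).mkQ a) = (leftKernel q).mkQ (TensorAlgebra.ι ℂ f * a) := rfl

theorem annihilator_mk (q : Data M) (f : M) (a : TensorAlgebra ℂ M) :
    annihilator q f ((leftKernel q).mkQ a) = (leftKernel q).mkQ (contract (q.w f) a) := rfl

/-- The field operators, depending linearly on the test function. -/
def fieldLin (q : Data M) : M →ₗ[ℂ] Module.End ℂ (GNS q) where
  toFun := field q
  map_add' f g := by
    refine LinearMap.ext fun Ψ => ?_
    obtain ⟨a, rfl⟩ := (leftKernel q).mkQ_surjective Ψ
    rw [LinearMap.add_apply, field_mk, field_mk, field_mk, ← map_add, ← add_mul, map_add]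
  map_smul' c f := by
    refine LinearMap.ext fun Ψ => ?_
    obtain ⟨a, rfl⟩ := (leftKernel q).mkQ_surjective Ψ
    rw [RingHom.id_apply, LinearMap.smul_apply, field_mk, field_mk, ← map_smul, map_smul,
      smul_mul_assoc]

/-- The annihilation operators, depending linearly on the test function. -/
def annihilatorLin (q : Data M) : M →ₗ[ℂ] Module.End ℂ (GNS q) where
  toFun := annihilator q
  map_add' f g := by
    refine LinearMap.ext fun Ψ => ?_
    obtain ⟨a, rfl⟩ := (leftKernel q).mkQ_surjective Ψ
    rw [LinearMap.add_apply, annihilator_mk, annihilator_mk, annihilator_mk, ← map_add, map_add,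
      contract_add]
  map_smul' c f := by
    refine LinearMap.ext fun Ψ => ?_
    obtain ⟨a, rfl⟩ := (leftKernel q).mkQ_surjective Ψ
    rw [RingHom.id_apply, LinearMap.smul_apply, annihilator_mk, annihilator_mk, ← map_smul,
      map_smul, contract_smul]

theorem fieldLin_apply (q : Data M) (f : M) : fieldLin q f = field q f := rfl

theorem annihilatorLin_apply (q : Data M) (f : M) : annihilatorLin q f = annihilator q f := rfl

theorem annihilator_vacuum (q : Data M) (f : M) : annihilator q f (vacuum q) = 0 := by
  rw [vacuum, annihilator_mk, contract_one, map_zero]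

/-- Annihilation parts depend on the test function only through `q.w f`. This is how on-shell
identities, false for the test functions themselves, become operator identities. -/
theorem annihilator_congr (q : Data M) {f g : M} (h : q.w f = q.w g) :
    annihilator q f = annihilator q g := by
  refine LinearMap.ext fun Ψ => ?_
  obtain ⟨a, rfl⟩ := (leftKernel q).mkQ_surjective Ψ
  rw [annihilator_mk, annihilator_mk, h]

/-- The commutator of an annihilation operator with a field operator. -/
theorem annihilator_field (q : Data M) (f g : M) (Ψ : GNS q) :
    annihilator q f (field q g Ψ) = field q g (annihilator q f Ψ) + q.w f g • Ψ := by
  obtain ⟨a, rfl⟩ := (leftKernel q).mkQ_surjective Ψ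
  rw [annihilator_mk, field_mk, annihilator_mk, contract_mul, contract_ι, map_add, field_mk,
    ← Algebra.smul_def, map_smul]

theorem annihilator_normalOrdered (q : Data M) (f : M) (s : SymmetricAlgebra ℂ M) :
    annihilator q f (normalOrdered q s) = normalOrdered q (contractSym (q.w f) s) := by
  obtain ⟨a, rfl⟩ := fockVector_surjective q s
  rw [contractSym_fockVector, normalOrdered_fockVector, normalOrdered_fockVector, annihilator_mk]

theorem normalOrdered_ι_mul (q : Data M) (f : M) (s : SymmetricAlgebra ℂ M) :
    normalOrdered q (SymmetricAlgebra.ι ℂ M f * s) =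
      field q f (normalOrdered q s) - annihilator q f (normalOrdered q s) := by
  rw [annihilator_normalOrdered, eq_sub_iff_add_eq, ← map_add]
  obtain ⟨a, rfl⟩ := fockVector_surjective q s
  rw [← fockVector_ι_mul, normalOrdered_fockVector, normalOrdered_fockVector, field_mk]

theorem innerProd_conj (q : Data M) (Ψ Φ : GNS q) :
    starRingEnd ℂ (innerProd q Ψ Φ) = innerProd q Φ Ψ := by
  obtain ⟨a, rfl⟩ := (leftKernel q).mkQ_surjective Ψ
  obtain ⟨b, rfl⟩ := (leftKernel q).mkQ_surjective Φ
  rw [innerProd_mk, innerProd_mk, ← wightman_adj, adj_mul, adj_adj]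

/-- The adjoint of a field operator. -/
theorem innerProd_field (q : Data M) (f : M) (Ψ Φ : GNS q) :
    innerProd q Ψ (field q f Φ) = innerProd q (field q (q.conj f) Ψ) Φ := by
  obtain ⟨a, rfl⟩ := (leftKernel q).mkQ_surjective Ψ
  obtain ⟨b, rfl⟩ := (leftKernel q).mkQ_surjective Φ
  rw [field_mk, field_mk, innerProd_mk, innerProd_mk, adj_mul, adj_ι, q.conj_conj, mul_assoc]

/-- The adjoint of a creation operator is an annihilation operator. -/
theorem innerProd_field_sub_annihilator (q : Data M) (f : M) (Ψ Φ : GNS q) :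
    innerProd q Ψ (field q f Φ - annihilator q f Φ) =
      innerProd q (annihilator q (q.conj f) Ψ) Φ := by
  obtain ⟨a, rfl⟩ := (leftKernel q).mkQ_surjective Ψ
  obtain ⟨b, rfl⟩ := (leftKernel q).mkQ_surjective Φ
  -- In `W(a* f b)` the factor `f` is contracted to its right and to its left; the subtracted
  -- annihilator cancels the right-hand contraction.
  rw [field_mk, annihilator_mk, annihilator_mk, map_sub, innerProd_mk, innerProd_mk, innerProd_mk,
    wightman_mul_ι_mul, adj_contract, q.conj_conj, add_sub_cancel_left]

/-- A field operator whose creation part vanishes is an annihilation operator. -/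
theorem annihilator_eq_field (q : Data M) {f : M} (hf : ∀ g, q.w g f = 0) :
    annihilator q f = field q f := by
  refine LinearMap.ext fun Ψ => ?_
  obtain ⟨a, rfl⟩ := (leftKernel q).mkQ_surjective Ψ
  rw [annihilator_mk, field_mk, eq_comm, ← sub_eq_zero, ← map_sub, Submodule.mkQ_apply,
    Submodule.Quotient.mk_eq_zero, mem_leftKernel']
  intro h
  have h0 : q.w.flip f = 0 := LinearMap.ext fun g => hf g
  have h1 : contract (0 : M →ₗ[ℂ] ℂ) h = 0 := by simpa using contract_smul 0 0 h
  rw [mul_sub, map_sub, wightman_mul_ι_mul, h0, h1, zero_mul, map_zero, add_zero, sub_self]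

/-- Removes one creator from the left vector at the cost of one contraction on the right: the
recursion that computes all Fock space inner products. -/
theorem innerProd_normalOrdered_ι_mul (q : Data M) (f : M) (s t : SymmetricAlgebra ℂ M) :
    innerProd q (normalOrdered q (SymmetricAlgebra.ι ℂ M f * s)) (normalOrdered q t) =
      innerProd q (normalOrdered q s) (normalOrdered q (contractSym (q.w (q.conj f)) t)) := by
  rw [← innerProd_conj, normalOrdered_ι_mul, innerProd_field_sub_annihilator, innerProd_conj,
    annihilator_normalOrdered]

theorem normalOrdered_one (q : Data M) : normalOrdered q 1 = vacuum q := by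
  rw [← fockVector_one q, normalOrdered_fockVector]; rfl

theorem innerProd_vacuum_normalOrdered (q : Data M) (t : SymmetricAlgebra ℂ M) :
    innerProd q (vacuum q) (normalOrdered q t) = SymmetricAlgebra.algebraMapInv t := by
  obtain ⟨b, rfl⟩ := fockVector_surjective q t
  rw [normalOrdered_fockVector, vacuum, innerProd_mk, adj_one, one_mul, wightman_eq_fockVector]

/-! ### Reduction to the annihilated one-particle vectors -/

/-- The substitution `g ↦ g - X ℓ(g) c` in the symmetric algebra. -/
def translation (ℓ : M →ₗ[ℂ] ℂ) (c : M) :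
    SymmetricAlgebra ℂ M →ₐ[ℂ] Polynomial (SymmetricAlgebra ℂ M) :=
  SymmetricAlgebra.lift
    ((Polynomial.CAlgHom (R := ℂ)).toLinearMap ∘ₗ SymmetricAlgebra.ι ℂ M -
      ℓ.smulRight (Polynomial.X * Polynomial.C (SymmetricAlgebra.ι ℂ M c)))

theorem translation_ι (ℓ : M →ₗ[ℂ] ℂ) (c g : M) :
    translation ℓ c (SymmetricAlgebra.ι ℂ M g) = Polynomial.C (SymmetricAlgebra.ι ℂ M g) -
      ℓ g • (Polynomial.X * Polynomial.C (SymmetricAlgebra.ι ℂ M c)) := by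
  simp [translation]

theorem translation_coeff_zero (ℓ : M →ₗ[ℂ] ℂ) (c : M) (s : SymmetricAlgebra ℂ M) :
    (translation ℓ c s).coeff 0 = s := by
  induction s using SymmetricAlgebra.induction with
  | algebraMap r => simp [Polynomial.algebraMap_apply]
  | ι x => simp [translation_ι]
  | mul a b ha hb => simp [Polynomial.mul_coeff_zero, ha, hb]
  | add a b ha hb => simp [ha, hb]

/-- The substitution moves `s` along the line of direction `-ℓ(·) c`, and `contractSym ℓ` is the
matching directional derivative, so this is the chain rule. -/
theorem derivative_translation (ℓ : M →ₗ[ℂ] ℂ) (c : M) (s : SymmetricAlgebra ℂ M) :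
    Polynomial.derivative (translation ℓ c s) =
      -(Polynomial.C (SymmetricAlgebra.ι ℂ M c) * translation ℓ c (contractSym ℓ s)) := by
  induction s using SymmetricAlgebra.induction with
  | algebraMap r => simp [contractSym_algebraMap, Polynomial.algebraMap_apply]
  | ι x =>
    rw [translation_ι, contractSym_ι, AlgHom.commutes, ← Algebra.commutes, ← Algebra.smul_def]
    simp only [map_sub, Polynomial.derivative_smul, Polynomial.derivative_mul,
      Polynomial.derivative_C, Polynomial.derivative_X, one_mul, mul_zero, add_zero, zero_sub]
  | mul a b ha hb =>
    rw [map_mul, Polynomial.derivative_mul, ha, hb, contractSym_mul, map_add, map_mul, map_mul]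
    ring
  | add a b ha hb => rw [map_add, map_add, ha, hb, map_add, map_add]; ring

/-- Taylor's formula: every coefficient of positive degree is a multiple of `c` times a coefficient
for `contractSym ℓ s`, hence lies in any suitably stable subspace containing that contraction. -/
theorem coeff_translation_succ (ℓ : M →ₗ[ℂ] ℂ) (c : M) (s : SymmetricAlgebra ℂ M) (n : ℕ) :
    (translation ℓ c s).coeff (n + 1) = (-((n : ℂ) + 1)⁻¹) •
      (SymmetricAlgebra.ι ℂ M c * (translation ℓ c (contractSym ℓ s)).coeff n) := by
  have h := congrArg (fun p => Polynomial.coeff p n) (derivative_translation ℓ c s)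
  simp only [Polynomial.coeff_derivative, Polynomial.coeff_neg, Polynomial.coeff_C_mul] at h
  have h2 : ((n : ℂ) + 1) • (translation ℓ c s).coeff (n + 1) =
      -(SymmetricAlgebra.ι ℂ M c * (translation ℓ c (contractSym ℓ s)).coeff n) := by
    rw [← h, Algebra.smul_def, mul_comm]; simp
  have hn : (n : ℂ) + 1 ≠ 0 := Nat.cast_add_one_ne_zero n
  rw [neg_smul, ← smul_neg, ← h2, smul_smul, inv_mul_cancel₀ hn, one_smul]

/-- The substitution `g ↦ g - ℓ(g) c` in the symmetric algebra. -/
def projection (ℓ : M →ₗ[ℂ] ℂ) (c : M) : SymmetricAlgebra ℂ M →ₐ[ℂ] SymmetricAlgebra ℂ M :=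
  SymmetricAlgebra.lift (SymmetricAlgebra.ι ℂ M ∘ₗ (LinearMap.id - ℓ.smulRight c))

theorem projection_ι (ℓ : M →ₗ[ℂ] ℂ) (c g : M) :
    projection ℓ c (SymmetricAlgebra.ι ℂ M g) = SymmetricAlgebra.ι ℂ M (g - ℓ g • c) := by
  simp [projection]

theorem eval_one_translation (ℓ : M →ₗ[ℂ] ℂ) (c : M) (s : SymmetricAlgebra ℂ M) :
    (translation ℓ c s).eval 1 = projection ℓ c s := by
  induction s using SymmetricAlgebra.induction with
  | algebraMap r => simp [Polynomial.algebraMap_apply]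
  | ι x => simp [translation_ι, projection_ι, Polynomial.eval_smul]
  | mul a b ha hb => simp [ha, hb]
  | add a b ha hb => simp [ha, hb]

/-- If the contraction of `s` with `ℓ` lies in an ideal stable under contraction with `ℓ`, then the
substitution `g ↦ g - ℓ(g) c` does not change `s` modulo the ideal. -/
theorem sub_projection_mem (K : Submodule ℂ (SymmetricAlgebra ℂ M))
    (hι : ∀ f, ∀ s ∈ K, SymmetricAlgebra.ι ℂ M f * s ∈ K) (ℓ : M →ₗ[ℂ] ℂ)
    (hℓ : ∀ s ∈ K, contractSym ℓ s ∈ K) (c : M) {s : SymmetricAlgebra ℂ M}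
    (hs : contractSym ℓ s ∈ K) : s - projection ℓ c s ∈ K := by
  have key : ∀ n, ∀ t ∈ K, (translation ℓ c t).coeff n ∈ K := by
    intro n
    induction n with
    | zero => intro t ht; rwa [translation_coeff_zero]
    | succ n ih =>
      intro t ht
      rw [coeff_translation_succ]
      exact K.smul_mem _ (hι _ _ (ih _ (hℓ t ht)))
  -- The value at `X = 1` is the sum of the coefficients. The constant one is `s` and cancels,
  -- leaving the higher Taylor coefficients.
  rw [← eval_one_translation, Polynomial.eval_eq_sum_range, Finset.sum_range_succ']
  simp only [one_pow, mul_one, translation_coeff_zero, sub_add_cancel_right]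
  refine K.neg_mem (K.sum_mem fun n _ => ?_)
  rw [coeff_translation_succ]
  exact K.smul_mem _ (hι _ _ (key n _ hs))

/-- The subalgebra of the symmetric algebra generated by a subspace. -/
def generated (U : Submodule ℂ M) : Subalgebra ℂ (SymmetricAlgebra ℂ M) :=
  Algebra.adjoin ℂ (SymmetricAlgebra.ι ℂ M '' U)

theorem generated_mono {U V : Submodule ℂ M} (h : U ≤ V) : generated U ≤ generated V :=
  Algebra.adjoin_mono (Set.image_mono h)

/-- A single element involves finitely many generators. This supplies the dimension for the
induction and the finite Gram matrix for positivity. -/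
theorem exists_finiteDimensional_generated {V : Submodule ℂ M} {s : SymmetricAlgebra ℂ M}
    (hs : s ∈ generated V) :
    ∃ U : Submodule ℂ M, U ≤ V ∧ FiniteDimensional ℂ U ∧ s ∈ generated U := by
  induction hs using Algebra.adjoin_induction with
  | mem x hx =>
    obtain ⟨g, hg, rfl⟩ := hx
    exact ⟨ℂ ∙ g, by simpa using hg, inferInstance,
      Algebra.subset_adjoin ⟨g, Submodule.mem_span_singleton_self g, rfl⟩⟩
  | algebraMap r => exact ⟨⊥, bot_le, inferInstance, Subalgebra.algebraMap_mem _ r⟩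
  | add x y _ _ hx hy =>
    obtain ⟨U, hU, _, hxU⟩ := hx
    obtain ⟨W, hW, _, hyW⟩ := hy
    exact ⟨U ⊔ W, sup_le hU hW, inferInstance,
      add_mem (generated_mono le_sup_left hxU) (generated_mono le_sup_right hyW)⟩
  | mul x y _ _ hx hy =>
    obtain ⟨U, hU, _, hxU⟩ := hx
    obtain ⟨W, hW, _, hyW⟩ := hy
    exact ⟨U ⊔ W, sup_le hU hW, inferInstance,
      mul_mem (generated_mono le_sup_left hxU) (generated_mono le_sup_right hyW)⟩

theorem mem_generated_top (s : SymmetricAlgebra ℂ M) : s ∈ generated (⊤ : Submodule ℂ M) := by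
  induction s using SymmetricAlgebra.induction with
  | algebraMap r => exact Subalgebra.algebraMap_mem _ r
  | ι x => exact Algebra.subset_adjoin ⟨x, trivial, rfl⟩
  | mul a b ha hb => exact mul_mem ha hb
  | add a b ha hb => exact add_mem ha hb

/-- Because `ℓ c = 1`, each `g - ℓ g • c` lies in the kernel of `ℓ`, and it stays in `U` since `c`
does. -/
theorem projection_mem_generated {ℓ : M →ₗ[ℂ] ℂ} {c : M} (hc : ℓ c = 1) {U : Submodule ℂ M}
    (hcU : c ∈ U) {s : SymmetricAlgebra ℂ M} (hs : s ∈ generated U) :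
    projection ℓ c s ∈ generated (U ⊓ LinearMap.ker ℓ) := by
  induction hs using Algebra.adjoin_induction with
  | mem x hx =>
    obtain ⟨g, hg, rfl⟩ := hx
    rw [projection_ι]
    exact Algebra.subset_adjoin ⟨_, ⟨U.sub_mem hg (U.smul_mem _ hcU), by simp [hc]⟩, rfl⟩
  | algebraMap r => rw [AlgHom.commutes]; exact Subalgebra.algebraMap_mem _ r
  | add x y _ _ hx hy => rw [map_add]; exact add_mem hx hy
  | mul x y _ _ hx hy => rw [map_mul]; exact mul_mem hx hy

/-- The one-particle vectors annihilated by `φ⁺(b)` for all `b ∈ N`. -/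
def annihilated (q : Data M) (N : Submodule ℂ M) : Submodule ℂ M :=
  ⨅ b ∈ N, LinearMap.ker (q.w b)

theorem mem_annihilated {q : Data M} {N : Submodule ℂ M} {g : M} :
    g ∈ annihilated q N ↔ ∀ b ∈ N, q.w b g = 0 := by
  simp [annihilated]

/-- Induction on the dimension of `U`. As long as some `b ∈ N` does not annihilate `U`, projecting
along a vector `c` with `q.w b c = 1` changes `s` only by an element of the radical and replaces `U`
by the strictly smaller `U ∩ ker (q.w b)`. -/
theorem exists_mem_generated_annihilated (q : Data M) (N : Submodule ℂ M) (n : ℕ) :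
    ∀ (U : Submodule ℂ M) [FiniteDimensional ℂ U], Module.finrank ℂ U ≤ n →
      ∀ s ∈ generated U, (∀ b ∈ N, contractSym (q.w b) s ∈ fockRadical q) →
        ∃ t ∈ generated (annihilated q N), s - t ∈ fockRadical q := by
  induction n with
  | zero =>
    intro U _ hU s hs _
    rw [Nat.le_zero, Submodule.finrank_eq_zero] at hU
    subst hU
    exact ⟨s, generated_mono bot_le hs, by simp⟩
  | succ n ih =>
    intro U _ hU s hs hb
    by_cases h : U ≤ annihilated q N
    · exact ⟨s, generated_mono h hs, by simp⟩
    obtain ⟨u, huU, hu⟩ := SetLike.not_le_iff_exists.1 h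
    rw [mem_annihilated] at hu
    push Not at hu
    obtain ⟨b, hbN, hbu⟩ := hu
    set c := (q.w b u)⁻¹ • u
    have hc : q.w b c = 1 := by simp [c, hbu]
    have hcU : c ∈ U := U.smul_mem _ huU
    have hp := sub_projection_mem (fockRadical q) (fun f s hs => ι_mul_mem_fockRadical q f hs)
      (q.w b) (fun s hs => contractSym_mem_fockRadical q b hs) c (hb b hbN)
    have hlt : U ⊓ LinearMap.ker (q.w b) < U :=
      lt_of_le_of_ne inf_le_left fun he => by
        have : c ∈ U ⊓ LinearMap.ker (q.w b) := by rw [he]; exact hcU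
        rw [Submodule.mem_inf, LinearMap.mem_ker, hc] at this
        exact one_ne_zero this.2
    have hfr := Submodule.finrank_lt_finrank_of_lt hlt
    have : FiniteDimensional ℂ ↥(U ⊓ LinearMap.ker (q.w b)) :=
      Submodule.finiteDimensional_of_le inf_le_left
    -- The projected element satisfies the same hypothesis: it differs from `s` by an element of the
    -- radical, which every contraction `q.w b'` preserves.
    obtain ⟨t, ht, hst⟩ := ih (U ⊓ LinearMap.ker (q.w b)) (by omega) (projection (q.w b) c s)
      (projection_mem_generated hc hcU hs) (fun b' hb' => by
        have h1 := contractSym_mem_fockRadical q b' hp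
        rw [map_sub] at h1
        have h2 := (fockRadical q).sub_mem (hb b' hb') h1
        rwa [sub_sub_cancel] at h2)
    exact ⟨t, ht, by simpa using (fockRadical q).add_mem hp hst⟩

/-! ### Positivity -/

/-- Chain rule for the derivation `contractSym ℓ` on a polynomial in the `u j`; only the variable
`i` contributes. -/
theorem contractSym_aeval {σ : Type*} [DecidableEq σ] (u : σ → M) (ℓ : M →ₗ[ℂ] ℂ) (i : σ)
    (h : ∀ j, j ≠ i → ℓ (u j) = 0) (p : MvPolynomial σ ℂ) :
    contractSym ℓ (MvPolynomial.aeval (fun j => SymmetricAlgebra.ι ℂ M (u j)) p) =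
      ℓ (u i) • MvPolynomial.aeval (fun j => SymmetricAlgebra.ι ℂ M (u j))
        (MvPolynomial.pderiv i p) := by
  induction p using MvPolynomial.induction_on with
  | C a => simp [contractSym_algebraMap]
  | add p q hp hq => simp [hp, hq]
  | mul_X p j hp =>
    rw [map_mul, contractSym_mul, hp, MvPolynomial.aeval_X, contractSym_ι, Derivation.leibniz,
      MvPolynomial.pderiv_X, map_add]
    by_cases hj : j = i
    · subst hj
      simp [Algebra.smul_def]
      ring
    · simp [h j hj, Pi.single_eq_of_ne hj, Algebra.smul_def]
      ring

/-- Creation monomials in orthogonal one-particle vectors are orthogonal. -/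
theorem innerProd_monomial (q : Data M) {σ : Type*} [DecidableEq σ] (u : σ → M)
    (hu : ∀ i j, i ≠ j → q.w (q.conj (u i)) (u j) = 0)
    (hpos : ∀ i, ∃ r : ℝ, 0 ≤ r ∧ q.w (q.conj (u i)) (u i) = r) (k : ℕ) :
    ∀ m : σ →₀ ℕ, m.degree = k → ∃ r : ℝ, 0 ≤ r ∧ ∀ n : σ →₀ ℕ, innerProd q
      (normalOrdered q (MvPolynomial.aeval (fun j => SymmetricAlgebra.ι ℂ M (u j))
        (MvPolynomial.monomial m (1 : ℂ))))
      (normalOrdered q (MvPolynomial.aeval (fun j => SymmetricAlgebra.ι ℂ M (u j))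
        (MvPolynomial.monomial n (1 : ℂ)))) = if m = n then (r : ℂ) else 0 := by
  induction k with
  | zero =>
    intro m hm
    rw [Finsupp.degree_eq_zero_iff] at hm
    subst hm
    refine ⟨1, zero_le_one, fun n => ?_⟩
    rw [MvPolynomial.monomial_zero', map_one, map_one, normalOrdered_one,
      innerProd_vacuum_normalOrdered]
    have h : (SymmetricAlgebra.algebraMapInv (R := ℂ) (M := M)).comp
        (MvPolynomial.aeval (fun j => SymmetricAlgebra.ι ℂ M (u j))) =
        MvPolynomial.aeval (0 : σ → ℂ) := by
      ext j; simp [SymmetricAlgebra.algebraMapInv_ι]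
    have h2 := DFunLike.congr_fun h (MvPolynomial.monomial n 1)
    rw [AlgHom.comp_apply, MvPolynomial.aeval_zero, MvPolynomial.constantCoeff_monomial] at h2
    rw [h2]
    simp [eq_comm]
  | succ k ih =>
    intro m hm
    obtain ⟨i, hi⟩ : ∃ i, m i ≠ 0 := by
      by_contra! h
      have : m = 0 := Finsupp.ext h
      simp [this] at hm
    have hle : Finsupp.single i 1 ≤ m := by
      rw [Finsupp.single_le_iff]; exact Nat.one_le_iff_ne_zero.2 hi
    obtain ⟨m', rfl⟩ := exists_add_of_le hle
    have hm' : m'.degree = k := by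
      rw [map_add, Finsupp.degree_single] at hm; omega
    obtain ⟨r, hr, hrn⟩ := ih m' hm'
    obtain ⟨d, hd, hdu⟩ := hpos i
    -- Moving one creator `u i` across gives its norm `d` and differentiates the right monomial,
    -- whose exponent of `u i` is `m' i + 1` when the two monomials agree.
    refine ⟨d * ((m' i + 1 : ℕ) * r), by positivity, fun n => ?_⟩
    have hX : (MvPolynomial.monomial (Finsupp.single i 1 + m') (1 : ℂ)) =
        MvPolynomial.X i * MvPolynomial.monomial m' 1 := by
      rw [MvPolynomial.X, MvPolynomial.monomial_mul, one_mul]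
    rw [hX, map_mul, MvPolynomial.aeval_X, innerProd_normalOrdered_ι_mul,
      contractSym_aeval u _ i (fun j hj => hu i j hj.symm), MvPolynomial.pderiv_monomial, map_smul,
      map_smul, hdu, one_mul]
    have hc : MvPolynomial.monomial (n - Finsupp.single i 1) ((n i : ℕ) : ℂ) =
        (n i : ℂ) • MvPolynomial.monomial (n - Finsupp.single i 1) 1 := by
      rw [MvPolynomial.smul_monomial, smul_eq_mul, mul_one]
    rw [hc, map_smul, map_smul, map_smul, hrn]
    -- Here the truncated exponent `n - single i 1` is meaningless, but its coefficient `n i`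
    -- vanishes.
    by_cases hn : n i = 0
    · have : Finsupp.single i 1 + m' ≠ n := by
        rintro rfl
        simp at hn
      simp [hn, this]
    · have hle' : Finsupp.single i 1 ≤ n := by
        rw [Finsupp.single_le_iff]; exact Nat.one_le_iff_ne_zero.2 hn
      obtain ⟨n', rfl⟩ := exists_add_of_le hle'
      rw [add_tsub_cancel_left]
      by_cases h : m' = n'
      · subst h
        simp [add_comm]
      · simp [h]

/-- Orthogonality of the monomials leaves only the diagonal sum of `|coefficient|²` times
nonnegative norms. -/
theorem innerProd_aeval_nonneg (q : Data M) {σ : Type*} [DecidableEq σ] (u : σ → M)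
    (hu : ∀ i j, i ≠ j → q.w (q.conj (u i)) (u j) = 0)
    (hpos : ∀ i, ∃ r : ℝ, 0 ≤ r ∧ q.w (q.conj (u i)) (u i) = r) (p : MvPolynomial σ ℂ) :
    0 ≤ (innerProd q
      (normalOrdered q (MvPolynomial.aeval (fun j => SymmetricAlgebra.ι ℂ M (u j)) p))
      (normalOrdered q (MvPolynomial.aeval (fun j => SymmetricAlgebra.ι ℂ M (u j)) p))).re := by
  choose r hr hrn using fun m => innerProd_monomial q u hu hpos (Finsupp.degree m) m rfl
  have hp : p = ∑ m ∈ p.support, p.coeff m • MvPolynomial.monomial m (1 : ℂ) := by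
    conv_lhs => rw [p.as_sum]
    refine Finset.sum_congr rfl fun m _ => ?_
    rw [MvPolynomial.smul_monomial, smul_eq_mul, mul_one]
  have hv : normalOrdered q (MvPolynomial.aeval (fun j => SymmetricAlgebra.ι ℂ M (u j)) p) =
      ∑ m ∈ p.support, p.coeff m • normalOrdered q
        (MvPolynomial.aeval (fun j => SymmetricAlgebra.ι ℂ M (u j))
          (MvPolynomial.monomial m (1 : ℂ))) := by
    conv_lhs => rw [hp]
    simp only [map_sum, map_smul]
  rw [hv]
  simp only [map_sum, LinearMap.sum_apply, LinearMap.map_smulₛₗ, LinearMap.smul_apply, hrn,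
    Complex.re_sum]
  simp only [smul_eq_mul, Finset.mul_sum, Complex.re_sum]
  refine Finset.sum_nonneg fun m hm => Finset.sum_nonneg fun n _ => ?_
  by_cases h : n = m
  · subst h
    rw [if_pos rfl, RingHom.id_apply, ← mul_assoc,
      mul_comm (p.coeff n), ← Complex.normSq_eq_conj_mul_self, ← Complex.ofReal_mul,
      Complex.ofReal_re]
    exact mul_nonneg (Complex.normSq_nonneg _) (hr n)
  · simp [h]

/-- Any finite family in a space with a Hermitean form lies in the span of an orthogonal family. -/
theorem exists_orthogonal_family (q : Data M) {n : Type*} [Fintype n] [DecidableEq n] (v : n → M) :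
    ∃ u : n → M, (∀ i, u i ∈ Submodule.span ℂ (Set.range v)) ∧
      (∀ i, v i ∈ Submodule.span ℂ (Set.range u)) ∧
      ∀ i j, i ≠ j → q.w (q.conj (u i)) (u j) = 0 := by
  -- The form may have null vectors, on which Gram–Schmidt would break down. Diagonalising the
  -- Hermitian Gram matrix works regardless, with eigenvectors as coefficients of the new family.
  set G : Matrix n n ℂ := Matrix.of fun i j => q.w (q.conj (v i)) (v j) with hGdef
  have hG : G.IsHermitian := by
    ext i j
    have h := q.w_conj (q.conj (v j)) (v i)
    rw [q.conj_conj] at h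
    rw [Matrix.conjTranspose_apply, hGdef, Matrix.of_apply, Matrix.of_apply, h]
    rfl
  let L : EuclideanSpace ℂ n →ₗ[ℂ] M :=
    { toFun := fun x => ∑ i, x i • v i
      map_add' := fun x y => by simp [add_smul, Finset.sum_add_distrib]
      map_smul' := fun c x => by simp [mul_smul, Finset.smul_sum] }
  have hL : ∀ x, L x = ∑ i, x i • v i := fun _ => rfl
  let e := hG.eigenvectorBasis
  refine ⟨fun j => L (e j), fun j => ?_, fun i => ?_, fun i j hij => ?_⟩
  · change L (e j) ∈ _
    rw [hL]
    exact Submodule.sum_mem _ fun i _ =>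
      Submodule.smul_mem _ _ (Submodule.subset_span ⟨i, rfl⟩)
  · have h1 : v i = L (EuclideanSpace.single i 1) := by
      rw [hL, Finset.sum_eq_single i] <;> simp +contextual
    rw [h1, ← e.sum_repr (EuclideanSpace.single i 1), map_sum]
    refine Submodule.sum_mem _ fun j _ => ?_
    rw [map_smul]
    exact Submodule.smul_mem _ _ (Submodule.subset_span ⟨j, rfl⟩)
  · have h2 : q.w (q.conj (L (e i))) (L (e j)) =
        ∑ k, starRingEnd ℂ (e i k) * (G.mulVec (e j)) k := by
      rw [hL, hL]
      simp only [map_sum, LinearMap.map_smulₛₗ, LinearMap.sum_apply, LinearMap.smul_apply,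
        Matrix.mulVec, dotProduct, Finset.mul_sum, smul_eq_mul, RingHom.id_apply]
      rw [Finset.sum_comm]
      refine Finset.sum_congr rfl fun k _ => Finset.sum_congr rfl fun l _ => ?_
      simp only [hGdef, Matrix.of_apply]
      ring
    have h3 : inner ℂ (e i) (e j) = 0 := e.orthonormal.2 hij
    rw [h2, hG.mulVec_eigenvectorBasis]
    rw [PiLp.inner_apply] at h3
    have h4 : ∀ k, starRingEnd ℂ (e i k) * (hG.eigenvalues j • ⇑(hG.eigenvectorBasis j)) k =
        hG.eigenvalues j • (inner ℂ (e i k) (e j k)) := by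
      intro k
      simp [e]
      ring
    rw [Finset.sum_congr rfl fun k _ => h4 k, ← Finset.smul_sum, h3, smul_zero]

/-- The Fock space form is positive on the symmetric algebra over a subspace on which the
one-particle form is positive. -/
theorem innerProd_nonneg_of_mem_generated (q : Data M) (V : Submodule ℂ M)
    (hV : ∀ g ∈ V, 0 ≤ (q.w (q.conj g) g).re) {s : SymmetricAlgebra ℂ M} (hs : s ∈ generated V) :
    0 ≤ (innerProd q (normalOrdered q s) (normalOrdered q s)).re := by
  classical
  obtain ⟨U, hUV, hU, hsU⟩ := exists_finiteDimensional_generated hs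
  let b := Module.finBasis ℂ U
  obtain ⟨u, huv, hvu, horth⟩ := exists_orthogonal_family q fun i => (b i : M)
  have hspan : Submodule.span ℂ (Set.range fun i => (b i : M)) = U := by
    have h := congrArg (Submodule.map U.subtype) b.span_eq
    rw [Submodule.map_span, ← Set.range_comp, Submodule.map_top, Submodule.range_subtype] at h
    exact h
  have hUu : U ≤ Submodule.span ℂ (Set.range u) := by
    refine hspan.ge.trans (Submodule.span_le.2 ?_)
    rintro _ ⟨i, rfl⟩
    exact hvu i
  have hreal : ∀ g, (q.w (q.conj g) g).im = 0 := fun g => by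
    have h := q.w_conj (q.conj g) g
    rw [q.conj_conj] at h
    exact Complex.conj_eq_iff_im.1 h.symm
  have hpos : ∀ i, ∃ r : ℝ, 0 ≤ r ∧ q.w (q.conj (u i)) (u i) = r := fun i =>
    ⟨_, hV (u i) (hUV (hspan ▸ huv i)), Complex.ext rfl (by simp [hreal])⟩
  have hrange : s ∈ (MvPolynomial.aeval (R := ℂ) fun j => SymmetricAlgebra.ι ℂ M (u j)).range := by
    refine Algebra.adjoin_le ?_ hsU
    rintro _ ⟨g, hg, rfl⟩
    have hg' := hUu hg
    clear hg
    induction hg' using Submodule.span_induction with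
    | mem x hx =>
      obtain ⟨i, rfl⟩ := hx
      exact ⟨MvPolynomial.X i, MvPolynomial.aeval_X _ _⟩
    | zero => rw [map_zero]; exact zero_mem _
    | add x y _ _ hx hy => rw [map_add]; exact add_mem hx hy
    | smul c x _ hx => rw [map_smul]; exact Subalgebra.smul_mem _ hx c
  obtain ⟨p, rfl⟩ := hrange
  exact innerProd_aeval_nonneg q u horth hpos p

/-- If the one-particle form is positive on the vectors annihilated by `φ⁺(b)` for all `b ∈ N`, then
the inner product is positive on all the vectors with this property. -/
theorem innerProd_nonneg_of_annihilator_eq_zero (q : Data M) (N : Submodule ℂ M)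
    (hN : ∀ g ∈ annihilated q N, 0 ≤ (q.w (q.conj g) g).re) (Ψ : GNS q)
    (hΨ : ∀ b ∈ N, annihilator q b Ψ = 0) : 0 ≤ (innerProd q Ψ Ψ).re := by
  obtain ⟨s, rfl⟩ := normalOrdered_surjective q Ψ
  obtain ⟨U, -, hU, hsU⟩ := exists_finiteDimensional_generated (mem_generated_top s)
  obtain ⟨t, ht, hst⟩ := exists_mem_generated_annihilated q N _ U le_rfl s hsU fun b hb => by
    rw [← normalOrdered_eq_zero, ← annihilator_normalOrdered, hΨ b hb]
  rw [← normalOrdered_eq_zero, map_sub, sub_eq_zero] at hst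
  rw [hst]
  exact innerProd_nonneg_of_mem_generated q _ hN ht

end QuasiFree

end

noncomputable section

namespace GuptaBleuler

open MeasureTheory SchwartzMap
open scoped LineDeriv FourierTransform

/-! ### Fourier transforms and the mass shell -/

theorem ft_add (f g : Scalar) (p : Spacetime) : ft (f + g) p = ft f p + ft g p := by
  simp [ft_eq, FourierAdd.fourier_add]

theorem ft_smul (c : ℂ) (f : Scalar) (p : Spacetime) : ft (c • f) p = c * ft f p := by
  simp [ft_eq, FourierSMul.fourier_smul]

/-- The Fourier transform at a fixed momentum, as a linear functional. -/
def ftLin (p : Spacetime) : Scalar →ₗ[ℂ] ℂ where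
  toFun h := ft h p
  map_add' f g := ft_add f g p
  map_smul' c f := ft_smul c f p

theorem ftLin_apply (p : Spacetime) (h : Scalar) : ftLin p h = ft h p := rfl

theorem ft_neg (f : Scalar) (p : Spacetime) : ft (-f) p = -ft f p := map_neg (ftLin p) f

theorem ft_sum {ι : Type*} (s : Finset ι) (f : ι → Scalar) (p : Spacetime) :
    ft (∑ i ∈ s, f i) p = ∑ i ∈ s, ft (f i) p := map_sum (ftLin p) f s

/-- The partial derivative as a linear map. -/
def pdLin (μ : Fin 4) : Scalar →ₗ[ℂ] Scalar where
  toFun := pd μ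
  map_add' := pd_add μ
  map_smul' := pd_smul μ

theorem pdUp_eq (μ : Fin 4) (h : Scalar) : pdUp μ h = (metric μ μ : ℂ) • pd μ h := by
  rw [pdUp, Finset.sum_eq_single μ]
  · intro ν _ hν
    simp [metric, hν.symm]
  · simp

theorem metric_mul_self (μ : Fin 4) : metric μ μ * metric μ μ = 1 := by
  fin_cases μ <;> simp [metric]

theorem metric_mul_self_complex (μ : Fin 4) : (metric μ μ : ℂ) * metric μ μ = 1 := by
  exact_mod_cast congrArg Complex.ofReal (metric_mul_self μ)

/-- The divergence `∂_μ f^μ` of a vector-valued test function. -/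
def divTest : VectorTest →ₗ[ℂ] Scalar := ∑ μ, pdLin μ ∘ₗ LinearMap.proj μ

theorem divTest_apply (f : VectorTest) : divTest f = ∑ μ, pd μ (f μ) := by
  rw [divTest, LinearMap.sum_apply]; rfl

theorem divTest_single (μ : Fin 4) (h : Scalar) : divTest (Pi.single μ h) = pd μ h := by
  rw [divTest_apply, Finset.sum_eq_single μ]
  · simp
  · intro ν _ hν
    rw [Pi.single_eq_of_ne hν]
    exact map_zero (pdLin ν)
  · simp

theorem ft_divTest (f : VectorTest) (p : Spacetime) :
    ft (divTest f) p = ∑ μ, -Complex.I * (lower p μ : ℂ) * ft (f μ) p := by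
  rw [divTest_apply, ft_sum]
  simp only [ft_pd]

theorem divTest_conjTest (f : VectorTest) : divTest (conjTest f) = conjScalar (divTest f) := by
  rw [divTest_apply, divTest_apply, conjScalar, map_sum]
  exact Finset.sum_congr rfl fun μ _ => pd_conj μ (f μ)

theorem mdot_self_neg (p : Spacetime) : mdot (-p) (-p) = mdot p p := by
  simp [mdot, lower_neg]

theorem mdot_self_eq (p : Spacetime) : mdot p p = ∑ μ, metric μ μ * (lower p μ * lower p μ) := by
  simp [mdot, lower, metric, Fin.sum_univ_four]

theorem mdot_shell (k : EuclideanSpace ℝ (Fin 3)) {s : ℝ} (hs : 0 ≤ s) :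
    mdot (shell k s) (shell k s) = s - ‖k‖ ^ 2 := by
  rw [EuclideanSpace.norm_sq_eq]
  simp [mdot, lower, metric, shell, Fin.sum_univ_four, Fin.sum_univ_three, Real.mul_self_sqrt hs]
  ring

theorem deltaLin_apply (Q : Scalar) :
    deltaLin Q = ∫ k : EuclideanSpace ℝ (Fin 3), energyDensity Q k (‖k‖ ^ 2) := rfl

theorem deltaLin_congr {Q R : Scalar} (h : ∀ k, Q (shell k (‖k‖ ^ 2)) = R (shell k (‖k‖ ^ 2))) :
    deltaLin Q = deltaLin R := by
  simp only [deltaLin_apply, energyDensity, h]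

theorem deltaLin_eq_zero {Q : Scalar} (h : ∀ k, Q (shell k (‖k‖ ^ 2)) = 0) : deltaLin Q = 0 := by
  rw [← map_zero deltaLin]
  exact deltaLin_congr h

theorem ae_ne_zero : ∀ᵐ k : EuclideanSpace ℝ (Fin 3), k ≠ 0 := by
  simp [ae_iff]

/-- `p² δ'(p²) = -δ(p²)`. -/
theorem deltaPrimePlus_mdot_mul (X : Scalar) {Q : Spacetime → ℂ}
    (hQ : ∀ p, Q p = (mdot p p : ℂ) * X p) : deltaPrimePlus Q = -deltaLin X := by
  rw [deltaPrimePlus, deltaLin_apply]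
  congr 1
  refine integral_congr_ae ?_
  filter_upwards [ae_ne_zero] with k hk
  have hk' : 0 < ‖k‖ := norm_pos_iff.2 hk
  have hcont : ContinuousAt (energyDensity X k) (‖k‖ ^ 2) := by
    have h1 : ContinuousAt (fun s => X (shell k s)) (‖k‖ ^ 2) :=
      X.continuous.continuousAt.comp (hasDerivAt_shell k hk).continuousAt
    have h2 : ContinuousAt (fun s : ℝ => 2 * (√s : ℂ)) (‖k‖ ^ 2) :=
      continuousAt_const.mul (Complex.continuous_ofReal.comp Real.continuous_sqrt).continuousAt
    exact h1.div h2 (by simp [Real.sqrt_sq, hk'.ne'])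
  have h : HasDerivAt (fun s : ℝ => ((s - ‖k‖ ^ 2 : ℝ) : ℂ) * energyDensity X k s)
      (energyDensity X k (‖k‖ ^ 2)) (‖k‖ ^ 2) := by
    -- The first factor vanishes at `‖k‖²`, so the slope there is the second factor itself and
    -- continuity suffices.
    rw [hasDerivAt_iff_tendsto_slope]
    refine (hcont.tendsto.mono_left nhdsWithin_le_nhds).congr' ?_
    filter_upwards [self_mem_nhdsWithin] with s hs
    have hs' : s - ‖k‖ ^ 2 ≠ 0 := sub_ne_zero.2 hs
    have hs'' : (s : ℂ) - ‖k‖ ^ 2 ≠ 0 := by exact_mod_cast hs'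
    rw [slope_def_module]
    simp only [sub_self, Complex.ofReal_zero, zero_mul, sub_zero, Complex.real_smul]
    push_cast
    rw [inv_mul_cancel_left₀ hs'']
  refine (h.congr_of_eventuallyEq ?_).deriv
  filter_upwards [lt_mem_nhds (show 0 < ‖k‖ ^ 2 by positivity)] with s hs
  rw [energyDensity, energyDensity, hQ, mdot_shell k hs.le, mul_div_assoc]

/-! ### The two-point function -/

/-- The left transform is taken at `-p`: two derivatives there give `(i p_μ)(i p_ν)`, whereas one on
each side gives `(i p_ν)(-i p_μ)`; hence the sign. -/
theorem sum_spec_pd_pd (f g : VectorTest) :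
    ∑ μ, ∑ ν, spec (pd μ (pd ν (f ν))) (g μ) = -spec (divTest f) (divTest g) := by
  ext p
  simp only [sum_apply, spec_pd]
  simp only [neg_apply, spec_apply, ft_divTest, lower_neg]
  rw [Finset.sum_mul_sum, Finset.sum_comm, ← Finset.sum_neg_distrib]
  refine Finset.sum_congr rfl fun ν _ => ?_
  rw [← Finset.sum_neg_distrib]
  refine Finset.sum_congr rfl fun μ _ => ?_
  push_cast
  linear_combination (-(lower p μ * lower p ν * ft (f ν) (-p) * ft (g μ) p) : ℂ) * Complex.I_sq

/-- `deltaPrimePlus` is additive only where derivatives and integrals exist. The factors `p_μ p_ν`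
provide both for each summand, so the sum can be taken under the integral and the derivative. -/
theorem sum_deltaPrimeLin (f g : VectorTest) :
    ∑ μ, ∑ ν, deltaPrimeLin μ ν (spec (f ν) (g μ)) =
      deltaPrimePlus (spec (divTest f) (divTest g)) := by
  have h1 : ∀ μ ν, deltaPrimeLin μ ν (spec (f ν) (g μ)) =
      -∫ k, derivFormula μ ν (spec (f ν) (g μ)) k := fun μ ν => deltaPrimePlus_eq _ _ _
  simp only [h1, Finset.sum_neg_distrib]
  rw [deltaPrimePlus]
  congr 1
  have h2 : ∀ μ, ∑ ν, ∫ k, derivFormula μ ν (spec (f ν) (g μ)) k =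
      ∫ k, ∑ ν, derivFormula μ ν (spec (f ν) (g μ)) k := fun μ =>
    (integral_finsetSum _ fun ν _ => integrable_derivFormula μ ν _).symm
  simp only [h2]
  rw [← integral_finsetSum _ fun μ _ =>
    integrable_finsetSum _ fun ν _ => integrable_derivFormula μ ν _]
  refine integral_congr_ae ?_
  filter_upwards [ae_ne_zero] with k hk
  have h := HasDerivAt.fun_sum (u := Finset.univ) fun μ _ =>
    HasDerivAt.fun_sum (u := Finset.univ) fun ν _ =>
      hasDerivAt_energyDensity μ ν (spec (f ν) (g μ)) k hk
  rw [← h.deriv]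
  congr 1
  ext s
  simp only [energyDensity, ← Finset.sum_div]
  congr 1
  have := congrArg (fun Q : Scalar => -Q (shell k s)) (sum_spec_pd_pd f g)
  simp only [sum_apply, spec_pd, neg_apply, neg_neg] at this
  rw [← this, ← Finset.sum_neg_distrib]
  refine Finset.sum_congr rfl fun μ _ => ?_
  rw [← Finset.sum_neg_distrib]
  refine Finset.sum_congr rfl fun ν _ => ?_
  ring

/-- The two-point function in momentum space. -/
theorem twoPoint_eq (κ ρ : ℝ) (f g : VectorTest) :
    twoPoint κ ρ f g = ((2 * Real.pi) ^ 4 : ℂ)⁻¹ *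
      (deltaLin (-∑ μ, (metric μ μ : ℂ) • spec (f μ) (g μ)) -
        ρ * deltaLin (spec (divTest f) (divTest g)) -
        κ * deltaPrimePlus (spec (divTest f) (divTest g))) := by
  simp only [twoPoint, Dplus_eq, Eplus_pd_eq, Finset.sum_add_distrib]
  have h1 : ∀ μ, ∑ ν, -(metric μ ν : ℂ) *
      (((2 * Real.pi) ^ 4 : ℂ)⁻¹ * deltaLin (spec (f ν) (g μ))) =
      -(metric μ μ : ℂ) * (((2 * Real.pi) ^ 4 : ℂ)⁻¹ * deltaLin (spec (f μ) (g μ))) := by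
    intro μ
    rw [Finset.sum_eq_single μ]
    · intro ν _ hν
      simp [metric, hν.symm]
    · simp
  have h2 := congrArg deltaLin (sum_spec_pd_pd f g)
  simp only [map_sum, map_neg] at h2
  have h3 := sum_deltaPrimeLin f g
  simp only [h1, map_neg, map_sum, map_smul, smul_eq_mul, ← Finset.mul_sum]
  have h4 : ∑ μ, -(metric μ μ : ℂ) * (((2 * Real.pi) ^ 4 : ℂ)⁻¹ * deltaLin (spec (f μ) (g μ))) =
      -(((2 * Real.pi) ^ 4 : ℂ)⁻¹ * ∑ μ, (metric μ μ : ℂ) * deltaLin (spec (f μ) (g μ))) := by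
    rw [Finset.mul_sum, ← Finset.sum_neg_distrib]
    exact Finset.sum_congr rfl fun μ _ => by ring
  rw [h2, h4]
  simp only [Finset.sum_neg_distrib]
  rw [h3]
  ring

/-- The test function of the field `B`: `B(h) = A(gaugeTest h)`. -/
def gaugeTest : Scalar →ₗ[ℂ] VectorTest where
  toFun h μ := -pdUp μ h
  map_add' f g := by
    ext1 μ; simp only [pdUp_eq, pd_add, Pi.add_apply, smul_add, neg_add]
  map_smul' c f := by
    ext1 μ; simp only [pdUp_eq, pd_smul, Pi.smul_apply, smul_neg, RingHom.id_apply, smul_comm c]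

theorem gaugeTest_apply (h : Scalar) (μ : Fin 4) : gaugeTest h μ = -pdUp μ h := rfl

theorem gaugeTest_eq_sum (h : Scalar) :
    gaugeTest h = ∑ μ, -(Pi.single μ (pdUp μ h) : VectorTest) := by
  rw [Finset.sum_neg_distrib, Finset.univ_sum_single fun μ => pdUp μ h]
  rfl

theorem conjTest_gaugeTest (h : Scalar) : conjTest (gaugeTest h) = gaugeTest (conjScalar h) := by
  ext μ x
  simp only [gaugeTest_apply, pdUp_eq, pd_conj]
  simp [conjTest, conjScalar_apply, gaugeTest_apply, pdUp_eq]

theorem ft_divTest_gaugeTest (h : Scalar) (p : Spacetime) :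
    ft (divTest (gaugeTest h)) p = (mdot p p : ℂ) * ft h p := by
  rw [ft_divTest, mdot_self_eq]
  push_cast
  rw [Finset.sum_mul]
  refine Finset.sum_congr rfl fun μ _ => ?_
  rw [gaugeTest_apply, ft_neg, pdUp_eq, ft_smul, ft_pd]
  linear_combination (-(metric μ μ * lower p μ * lower p μ * ft h p) : ℂ) * Complex.I_sq

/-- The divergence of `gaugeTest h` is `p² ĥ`. The `ρ` term dies on the cone, `p² δ' = -δ` turns the
`κ` term into `κ δ`, and the metric term contributes `-δ`. -/
theorem twoPoint_gaugeTest_left (κ ρ : ℝ) (h : Scalar) (g : VectorTest) :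
    twoPoint κ ρ (gaugeTest h) g =
      ((2 * Real.pi) ^ 4 : ℂ)⁻¹ * ((κ - 1) * deltaLin (spec h (divTest g))) := by
  have h1 : ∀ p, spec (divTest (gaugeTest h)) (divTest g) p =
      (mdot p p : ℂ) * spec h (divTest g) p := by
    intro p
    rw [spec_apply, spec_apply, ft_divTest_gaugeTest, mdot_self_neg, mul_assoc]
  have h2 : deltaLin (spec (divTest (gaugeTest h)) (divTest g)) = 0 :=
    deltaLin_eq_zero fun k => by rw [h1, mdot_shell k (by positivity)]; simp
  have h3 : -∑ μ, (metric μ μ : ℂ) • spec (gaugeTest h μ) (g μ) = -spec h (divTest g) := by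
    ext p
    rw [neg_apply, neg_apply, sum_apply, spec_apply, ft_divTest, Finset.mul_sum]
    congr 1
    refine Finset.sum_congr rfl fun μ _ => ?_
    rw [smul_apply, spec_apply, gaugeTest_apply, ft_neg, pdUp_eq, ft_smul, ft_pd, lower_neg,
      smul_eq_mul]
    push_cast
    linear_combination (-(Complex.I * lower p μ * ft h (-p) * ft (g μ) p) : ℂ) *
      metric_mul_self_complex μ
  rw [twoPoint_eq, h2, deltaPrimePlus_mdot_mul _ h1, h3, map_neg]
  ring

theorem twoPoint_gaugeTest_right (κ ρ : ℝ) (h : Scalar) (g : VectorTest) :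
    twoPoint κ ρ g (gaugeTest h) = starRingEnd ℂ (((2 * Real.pi) ^ 4 : ℂ)⁻¹ *
      ((κ - 1) * deltaLin (spec (conjScalar h) (divTest (conjTest g))))) := by
  rw [← twoPoint_gaugeTest_left κ ρ, ← twoPoint_conj, conjTest_conjTest, ← conjTest_gaugeTest,
    conjTest_conjTest]

/-- The test function of the field strength: `F_{νμ}(h) = A(fieldTest ν μ h)`. -/
def fieldTest (ν μ : Fin 4) (h : Scalar) : VectorTest :=
  -Pi.single ν (pd μ h) - -Pi.single μ (pd ν h)

theorem ft_divTest_fieldTest (ν μ : Fin 4) (h : Scalar) (p : Spacetime) :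
    ft (divTest (fieldTest ν μ h)) p = 0 := by
  rw [fieldTest, map_sub, map_neg, map_neg, divTest_single, divTest_single, ← ftLin_apply, map_sub,
    map_neg, map_neg, ftLin_apply, ftLin_apply, ft_pd, ft_pd, ft_pd, ft_pd]
  ring

/-- The commutator of `B⁺` with `F` vanishes: `B⁺` sees only the divergence, which is zero by
antisymmetry of `F`. -/
theorem twoPoint_gaugeTest_fieldTest (κ ρ : ℝ) (h h' : Scalar) (ν μ : Fin 4) :
    twoPoint κ ρ (gaugeTest h') (fieldTest ν μ h) = 0 := by
  rw [twoPoint_gaugeTest_left, deltaLin_eq_zero, mul_zero, mul_zero]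
  intro k
  rw [spec_apply, ft_divTest_fieldTest, mul_zero]

theorem conjTest_single (μ : Fin 4) (h : Scalar) :
    conjTest (Pi.single μ h) = Pi.single μ (conjScalar h) := by
  ext1 ν
  change conjScalar _ = _
  by_cases hν : ν = μ
  · subst hν; simp
  · rw [Pi.single_eq_of_ne hν, Pi.single_eq_of_ne hν]; exact map_zero _

theorem conjTest_fieldTest (ν μ : Fin 4) (h : Scalar) :
    conjTest (fieldTest ν μ h) = fieldTest ν μ (conjScalar h) := by
  rw [fieldTest, map_sub, map_neg, map_neg, conjTest_single, conjTest_single, fieldTest, pd_conj,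
    pd_conj]

theorem sum_metric_spec_single (ν : Fin 4) (u : Scalar) (g : VectorTest) (p : Spacetime) :
    ∑ μ, (metric μ μ : ℂ) * (ft ((Pi.single ν u : VectorTest) μ) (-p) * ft (g μ) p) =
      (metric ν ν : ℂ) * (ft u (-p) * ft (g ν) p) := by
  rw [Finset.sum_eq_single ν]
  · simp
  · intro μ _ hμ
    rw [Pi.single_eq_of_ne hμ, ← ftLin_apply, map_zero]
    ring
  · simp

/-- Gauge independence: the `ρ` and `κ` terms involve only divergences, so they drop out for the
transverse test functions of `F`. -/
theorem twoPoint_fieldTest_left (κ ρ : ℝ) (ν μ : Fin 4) (h : Scalar) (g : VectorTest) :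
    twoPoint κ ρ (fieldTest ν μ h) g = ((2 * Real.pi) ^ 4 : ℂ)⁻¹ *
      deltaLin ((metric ν ν : ℂ) • spec (pd μ h) (g ν) -
        (metric μ μ : ℂ) • spec (pd ν h) (g μ)) := by
  have h1 : spec (divTest (fieldTest ν μ h)) (divTest g) = 0 := by
    ext p
    rw [spec_apply, ft_divTest_fieldTest, zero_mul, zero_apply]
  have h2 : deltaPrimePlus (0 : Scalar) = 0 := by
    have := deltaPrimePlus_mdot_mul (0 : Scalar) (Q := (0 : Scalar)) (fun p => by simp)
    rwa [map_zero, neg_zero] at this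
  rw [twoPoint_eq, h1, h2, map_zero, mul_zero, mul_zero, sub_zero, sub_zero]
  congr 2
  ext p
  rw [neg_apply, sum_apply, sub_apply, smul_apply, smul_apply]
  have h3 : ∀ l, ((metric l l : ℂ) • spec (fieldTest ν μ h l) (g l)) p =
      -((metric l l : ℂ) * (ft ((Pi.single ν (pd μ h) : VectorTest) l) (-p) * ft (g l) p)) +
      (metric l l : ℂ) * (ft ((Pi.single μ (pd ν h) : VectorTest) l) (-p) * ft (g l) p) := by
    intro l
    rw [smul_apply, spec_apply, fieldTest, Pi.sub_apply, Pi.neg_apply, Pi.neg_apply,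
      sub_neg_eq_add, ft_add, ft_neg, smul_eq_mul]
    ring
  simp only [h3, Finset.sum_add_distrib, Finset.sum_neg_distrib, sum_metric_spec_single,
    spec_apply, smul_eq_mul]
  ring

/-- The test function of the divergence of the field strength. -/
def divFieldTest (μ : Fin 4) (h : Scalar) : VectorTest := ∑ ν, -fieldTest ν μ (pdUp ν h)

theorem conjScalar_pdUp (μ : Fin 4) (h : Scalar) :
    conjScalar (pdUp μ h) = pdUp μ (conjScalar h) := by
  ext x
  simp [conjScalar_apply, pdUp_eq, pd_conj]

theorem conjTest_divFieldTest (μ : Fin 4) (h : Scalar) :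
    conjTest (divFieldTest μ h) = divFieldTest μ (conjScalar h) := by
  simp only [divFieldTest, map_sum, map_neg, conjTest_fieldTest, conjScalar_pdUp]

/-- The annihilation part of `∂^ν F_{νμ}` is proportional to that of `∂_μ B`. -/
theorem twoPoint_divFieldTest_left {κ : ℝ} (hκ : κ ≠ 1) (ρ : ℝ) (μ : Fin 4) (h : Scalar)
    (g : VectorTest) :
    twoPoint κ ρ (divFieldTest μ h) g =
      twoPoint κ ρ (gaugeTest (((κ : ℂ) - 1)⁻¹ • pd μ h)) g := by
  have hκ' : (κ : ℂ) - 1 ≠ 0 := sub_ne_zero.2 (by exact_mod_cast hκ)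
  have h1 : twoPoint κ ρ (divFieldTest μ h) g =
      -∑ ν, twoPoint κ ρ (fieldTest ν μ (pdUp ν h)) g := by
    change twoPointLin κ ρ _ g = -∑ ν, twoPointLin κ ρ _ g
    rw [divFieldTest, map_sum, LinearMap.sum_apply, ← Finset.sum_neg_distrib]
    simp only [map_neg, LinearMap.neg_apply]
  rw [h1, twoPoint_gaugeTest_left, spec_smul_left, map_smul, smul_eq_mul, mul_inv_cancel_left₀ hκ']
  simp only [twoPoint_fieldTest_left, ← Finset.mul_sum]
  rw [← mul_neg, ← map_sum, ← map_neg]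
  congr 1
  refine deltaLin_congr fun k => ?_
  -- On the cone `p² = 0`, which removes the `□ A_μ` part of `∂^ν F_{νμ}` and leaves `p_μ` times the
  -- divergence.
  have h0 := mdot_shell k (s := ‖k‖ ^ 2) (by positivity)
  set p := shell k (‖k‖ ^ 2)
  rw [sub_self, mdot_self_eq] at h0
  have h0' : ∑ ν, (metric ν ν : ℂ) * (lower p ν * lower p ν) = 0 := by exact_mod_cast h0
  rw [neg_apply, sum_apply]
  have h2 : ∀ ν, ((metric ν ν : ℂ) • spec (pd μ (pdUp ν h)) (g ν) -
      (metric μ μ : ℂ) • spec (pd ν (pdUp ν h)) (g μ)) p =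
      -((lower p μ : ℂ) * lower p ν * ft h (-p) * ft (g ν) p) +
      (metric ν ν : ℂ) * (lower p ν * lower p ν) *
        ((metric μ μ : ℂ) * (ft h (-p) * ft (g μ) p)) := by
    intro ν
    rw [sub_apply, smul_apply, smul_apply, smul_eq_mul, smul_eq_mul, pdUp_eq, pd_smul, pd_smul,
      spec_smul_left, spec_smul_left, smul_apply, smul_apply, spec_pd, spec_pd, spec_apply,
      spec_apply, smul_eq_mul, smul_eq_mul]
    linear_combination (-(lower p μ * lower p ν * ft h (-p) * ft (g ν) p) : ℂ) *
      metric_mul_self_complex ν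
  simp only [h2, Finset.sum_add_distrib, ← Finset.sum_mul, h0', zero_mul, add_zero]
  rw [Finset.sum_neg_distrib, neg_neg, spec_apply, ft_divTest, ft_pd, lower_neg, Finset.mul_sum]
  refine Finset.sum_congr rfl fun ν _ => ?_
  push_cast
  linear_combination ((lower p μ * lower p ν * ft h (-p) * ft (g ν) p) : ℂ) * Complex.I_sq

/-! ### Positivity of the two-point function on transverse test functions -/

theorem spec_conjScalar_self (u : Scalar) (p : Spacetime) :
    spec (conjScalar u) u p = (Complex.normSq (ft u p) : ℂ) := by
  rw [spec_apply, ft_conj, neg_neg, Complex.normSq_eq_conj_mul_self]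

theorem energyDensity_spec_conjScalar_self (u : Scalar) (k : EuclideanSpace ℝ (Fin 3)) (s : ℝ) :
    energyDensity (spec (conjScalar u) u) k s =
      ((Complex.normSq (ft u (shell k s)) / (2 * √s) : ℝ) : ℂ) := by
  rw [energyDensity, spec_conjScalar_self]
  push_cast
  rfl

theorem ft_shell_ae_eq_zero {u : Scalar} (hu : deltaLin (spec (conjScalar u) u) = 0) :
    ∀ᵐ k : EuclideanSpace ℝ (Fin 3), ft u (shell k (‖k‖ ^ 2)) = 0 := by
  have hint := (integrable_energyDensity (spec (conjScalar u) u)).re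
  rw [deltaLin_apply] at hu
  simp only [energyDensity_spec_conjScalar_self] at hu hint
  have hint' : Integrable (fun k : EuclideanSpace ℝ (Fin 3) =>
      Complex.normSq (ft u (shell k (‖k‖ ^ 2))) / (2 * √(‖k‖ ^ 2))) := hint
  rw [integral_complex_ofReal, Complex.ofReal_eq_zero,
    integral_eq_zero_iff_of_nonneg (fun k => by
      have := Complex.normSq_nonneg (ft u (shell k (‖k‖ ^ 2)))
      positivity) hint'] at hu
  filter_upwards [hu, ae_ne_zero] with k hk hk0
  have hk' : ‖k‖ ≠ 0 := norm_ne_zero_iff.2 hk0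
  simpa [Real.sqrt_sq, hk'] using hk

/-- Along `s = (p⁰)²` the density `|û|² / (2√s)` is nonnegative and vanishes on the cone, so it has
a minimum there and its derivative is zero. -/
theorem deltaPrimePlus_spec_conjScalar_self {u : Scalar}
    (hu : ∀ᵐ k : EuclideanSpace ℝ (Fin 3), ft u (shell k (‖k‖ ^ 2)) = 0) :
    deltaPrimePlus (spec (conjScalar u) u) = 0 := by
  rw [deltaPrimePlus, neg_eq_zero]
  refine integral_eq_zero_of_ae ?_
  filter_upwards [hu] with k hk
  -- Without differentiability `deriv` takes the default value `0`, so smoothness need not be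
  -- checked.
  by_cases hd : DifferentiableAt ℝ (energyDensity (spec (conjScalar u) u) k) (‖k‖ ^ 2)
  swap
  · exact deriv_zero_of_not_differentiableAt hd
  have h := hd.hasDerivAt
  have hre := Complex.reCLM.hasFDerivAt.comp_hasDerivAt _ h
  have him := Complex.imCLM.hasFDerivAt.comp_hasDerivAt _ h
  refine Complex.ext (IsLocalMin.hasDerivAt_eq_zero ?_ hre) (IsLocalMin.hasDerivAt_eq_zero ?_ him)
  · refine Filter.Eventually.of_forall fun s => ?_
    simp only [Function.comp_apply, Complex.reCLM_apply, energyDensity_spec_conjScalar_self,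
      Complex.ofReal_re, hk, map_zero, zero_div]
    have := Complex.normSq_nonneg (ft u (shell k s))
    positivity
  · refine Filter.Eventually.of_forall fun s => ?_
    simp only [Function.comp_apply, Complex.imCLM_apply, energyDensity_spec_conjScalar_self,
      Complex.ofReal_im, le_refl]

/-- Transversality reads `‖k‖ a⁰ = k · a`, and Cauchy–Schwarz bounds the right side. The squares
supplied at the end are those of Lagrange's identity. -/
theorem sq_le_of_transverse {k : EuclideanSpace ℝ (Fin 3)} (hk : k ≠ 0) {a : Fin 4 → ℝ}
    (h : ∑ μ, lower (shell k (‖k‖ ^ 2)) μ * a μ = 0) :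
    a 0 ^ 2 ≤ a 1 ^ 2 + a 2 ^ 2 + a 3 ^ 2 := by
  have hk' : 0 < ‖k‖ ^ 2 := by have := norm_pos_iff.2 hk; positivity
  have h1 : ‖k‖ * a 0 = k 0 * a 1 + k 1 * a 2 + k 2 * a 3 := by
    rw [shell_norm_sq] at h
    simp [lower, metric, Fin.sum_univ_four] at h
    linarith
  have h2 := EuclideanSpace.norm_sq_eq k
  simp only [Fin.sum_univ_three, Real.norm_eq_abs, sq_abs] at h2
  refine le_of_mul_le_mul_left ?_ hk'
  have h3 : ‖k‖ ^ 2 * a 0 ^ 2 = (k 0 * a 1 + k 1 * a 2 + k 2 * a 3) ^ 2 := by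
    rw [← h1]; ring
  rw [h3, h2]
  nlinarith [sq_nonneg (k 0 * a 2 - k 1 * a 1), sq_nonneg (k 0 * a 3 - k 2 * a 1),
    sq_nonneg (k 1 * a 3 - k 2 * a 2)]

/-- The momentum is real, so real and imaginary parts of `v` are separately transverse. -/
theorem transverse_nonneg {k : EuclideanSpace ℝ (Fin 3)} (hk : k ≠ 0) {v : Fin 4 → ℂ}
    (h : ∑ μ, (lower (shell k (‖k‖ ^ 2)) μ : ℂ) * v μ = 0) :
    0 ≤ -∑ μ, metric μ μ * Complex.normSq (v μ) := by
  have hre := congrArg Complex.re h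
  have him := congrArg Complex.im h
  simp only [Complex.re_sum, Complex.im_sum, Complex.re_ofReal_mul, Complex.im_ofReal_mul,
    Complex.zero_re, Complex.zero_im] at hre him
  have h1 := sq_le_of_transverse hk hre
  have h2 := sq_le_of_transverse hk him
  simp only [Fin.sum_univ_four, Complex.normSq_apply, metric]
  simp
  nlinarith

/-- The two-point function is positive on transverse test functions. -/
theorem twoPoint_conjTest_self_nonneg (κ ρ : ℝ) {g : VectorTest}
    (hg : deltaLin (spec (conjScalar (divTest g)) (divTest g)) = 0) :
    0 ≤ (twoPoint κ ρ (conjTest g) g).re := by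
  have hae := ft_shell_ae_eq_zero hg
  rw [twoPoint_eq, divTest_conjTest, hg, deltaPrimePlus_spec_conjScalar_self hae, mul_zero,
    mul_zero, sub_zero, sub_zero]
  have hc : ((2 * Real.pi) ^ 4 : ℂ)⁻¹ = (((2 * Real.pi) ^ 4)⁻¹ : ℝ) := by push_cast; rfl
  rw [hc, Complex.re_ofReal_mul]
  refine mul_nonneg (by positivity) ?_
  rw [deltaLin_apply]
  have hre : ∀ Q : Scalar, (∫ k, energyDensity Q k (‖k‖ ^ 2)).re =
      ∫ k, (energyDensity Q k (‖k‖ ^ 2)).re := fun Q =>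
    (Complex.reCLM.integral_comp_comm (integrable_energyDensity Q)).symm
  rw [hre]
  refine integral_nonneg_of_ae ?_
  filter_upwards [hae, ae_ne_zero] with k hk hk0
  rw [ft_divTest] at hk
  have h1 : ∑ μ, (lower (shell k (‖k‖ ^ 2)) μ : ℂ) * ft (g μ) (shell k (‖k‖ ^ 2)) = 0 := by
    simp only [mul_assoc, ← Finset.mul_sum] at hk
    simpa using hk
  have h2 := transverse_nonneg hk0 h1
  have h3 : energyDensity (-∑ μ, (metric μ μ : ℂ) • spec (conjTest g μ) (g μ) : Scalar) k
      (‖k‖ ^ 2) = (((-∑ μ, metric μ μ * Complex.normSq (ft (g μ) (shell k (‖k‖ ^ 2)))) /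
        (2 * √(‖k‖ ^ 2)) : ℝ) : ℂ) := by
    rw [energyDensity, neg_apply, sum_apply]
    push_cast
    congr 2
    refine Finset.sum_congr rfl fun μ _ => ?_
    rw [Pi.smul_apply, smul_eq_mul, ← spec_conjScalar_self]
    rfl
  rw [h3, Complex.ofReal_re]
  exact div_nonneg h2 (by positivity)

/-! ### The fields in terms of their test functions -/

theorem gaugeFieldPlus_eq (κ ρ : ℝ) (h : Scalar) :
    gaugeFieldPlus κ ρ h = QuasiFree.annihilator (potentialData κ ρ) (gaugeTest h) := by
  rw [← QuasiFree.annihilatorLin_apply, gaugeTest_eq_sum, map_sum]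
  simp only [map_neg]
  rfl

theorem gaugeField_eq (κ ρ : ℝ) (h : Scalar) :
    gaugeField κ ρ h = QuasiFree.field (potentialData κ ρ) (gaugeTest h) := by
  rw [← QuasiFree.fieldLin_apply, gaugeTest_eq_sum, map_sum]
  simp only [map_neg]
  rfl

theorem fieldStrength_eq (κ ρ : ℝ) (ν μ : Fin 4) (h : Scalar) :
    fieldStrength κ ρ ν μ h = QuasiFree.field (potentialData κ ρ) (fieldTest ν μ h) := by
  rw [← QuasiFree.fieldLin_apply, fieldTest, map_sub, map_neg, map_neg]
  rfl

theorem divFieldStrength_eq (κ ρ : ℝ) (μ : Fin 4) (h : Scalar) :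
    divFieldStrength κ ρ μ h = QuasiFree.field (potentialData κ ρ) (divFieldTest μ h) := by
  rw [← QuasiFree.fieldLin_apply, divFieldTest, map_sum]
  simp only [map_neg, QuasiFree.fieldLin_apply, ← fieldStrength_eq]
  rfl

theorem mem_physical {κ ρ : ℝ} {Ψ : Domain κ ρ} :
    Ψ ∈ physical κ ρ ↔
      ∀ h, QuasiFree.annihilator (potentialData κ ρ) (gaugeTest h) Ψ = 0 := by
  simp [physical, gaugeFieldPlus_eq]

/-- With `B` in the right slot the two-point function sees `ĥ` only on the forward cone, so the
creation part vanishes. For the annihilation part, with `B` on the left, the argument is `-p` and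
the backward cone matters. -/
theorem gaugeFieldPlus_eq_gaugeField (κ ρ : ℝ) {h : Scalar}
    (hh : ∀ k, ft h (shell k (‖k‖ ^ 2)) = 0) : gaugeFieldPlus κ ρ h = gaugeField κ ρ h := by
  rw [gaugeFieldPlus_eq, gaugeField_eq]
  refine QuasiFree.annihilator_eq_field _ fun g => ?_
  change twoPoint κ ρ g (gaugeTest h) = 0
  rw [twoPoint_gaugeTest_right, deltaLin_eq_zero, mul_zero, mul_zero, map_zero]
  intro k
  rw [spec_apply, ft_conj, neg_neg, hh, map_zero, zero_mul]

theorem gaugeFieldPlus_eq_zero (κ ρ : ℝ) {h : Scalar}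
    (hh : ∀ k, ft h (-shell k (‖k‖ ^ 2)) = 0) : gaugeFieldPlus κ ρ h = 0 := by
  rw [gaugeFieldPlus_eq, QuasiFree.annihilator_congr (potentialData κ ρ) (g := 0),
    ← QuasiFree.annihilatorLin_apply,
    map_zero]
  refine LinearMap.ext fun g => ?_
  rw [map_zero]
  change twoPoint κ ρ (gaugeTest h) g = 0
  rw [twoPoint_gaugeTest_left, deltaLin_eq_zero, mul_zero, mul_zero]
  intro k
  rw [spec_apply, hh, zero_mul]

/-! ### The physical states -/

theorem vacuum_mem_physical (κ ρ : ℝ) : vacuum κ ρ ∈ physical κ ρ :=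
  mem_physical.2 fun _ => QuasiFree.annihilator_vacuum _ _

theorem fieldStrength_mem_physical {κ ρ : ℝ} (ν μ : Fin 4) (h : Scalar) {Ψ : Domain κ ρ}
    (hΨ : Ψ ∈ physical κ ρ) : fieldStrength κ ρ ν μ h Ψ ∈ physical κ ρ := by
  rw [mem_physical] at hΨ ⊢
  intro h'
  have hw : (potentialData κ ρ).w (gaugeTest h') (fieldTest ν μ h) = 0 :=
    twoPoint_gaugeTest_fieldTest κ ρ h h' ν μ
  rw [fieldStrength_eq, QuasiFree.annihilator_field, hΨ, map_zero, hw, zero_smul, add_zero]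

theorem deltaLin_divTest_eq_zero {κ ρ : ℝ} (hκ : κ ≠ 1) {h : Scalar} {g : VectorTest}
    (hg : twoPoint κ ρ (gaugeTest h) g = 0) : deltaLin (spec h (divTest g)) = 0 := by
  have hκ' : (κ : ℂ) - 1 ≠ 0 := sub_ne_zero.2 (by exact_mod_cast hκ)
  have hpi : (Real.pi : ℂ) ≠ 0 := Complex.ofReal_ne_zero.2 Real.pi_ne_zero
  rw [twoPoint_gaugeTest_left] at hg
  simpa [hκ', hpi] using hg

theorem innerProd_self_im (κ ρ : ℝ) (Ψ : Domain κ ρ) : (innerProd κ ρ Ψ Ψ).im = 0 :=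
  Complex.conj_eq_iff_im.1 (QuasiFree.innerProd_conj (potentialData κ ρ) Ψ Ψ)

theorem innerProd_self_nonneg {κ ρ : ℝ} (hκ : κ ≠ 1) {Ψ : Domain κ ρ} (hΨ : Ψ ∈ physical κ ρ) :
    0 ≤ (innerProd κ ρ Ψ Ψ).re := by
  rw [mem_physical] at hΨ
  refine QuasiFree.innerProd_nonneg_of_annihilator_eq_zero (potentialData κ ρ)
    (LinearMap.range gaugeTest) (fun g hg => ?_) Ψ ?_
  · rw [QuasiFree.mem_annihilated] at hg
    exact twoPoint_conjTest_self_nonneg κ ρ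
      -- Choosing `h` as the conjugate of the divergence turns the annihilation condition into the
      -- vanishing of its `L²` norm on the cone.
      (deltaLin_divTest_eq_zero hκ (hg _ ⟨conjScalar (divTest g), rfl⟩))
  · rintro _ ⟨h, rfl⟩
    exact hΨ h

/-- A null vector of a positive semidefinite Hermitean form is orthogonal to everything. -/
theorem innerProd_eq_zero_of_null {κ ρ : ℝ} (hκ : κ ≠ 1) {Ψ Φ : Domain κ ρ}
    (hΨ : Ψ ∈ physical κ ρ) (hΨ0 : innerProd κ ρ Ψ Ψ = 0) (hΦ : Φ ∈ physical κ ρ) :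
    innerProd κ ρ Φ Ψ = 0 := by
  set c := innerProd κ ρ Φ Ψ with hc
  -- Since `⟨Ψ, Ψ⟩ = 0` there is no quadratic term, and an affine function of `t` that stays
  -- nonnegative has slope zero.
  have hexp : ∀ t : ℝ, (innerProd κ ρ (Φ - ((t : ℂ) * starRingEnd ℂ c) • Ψ)
      (Φ - ((t : ℂ) * starRingEnd ℂ c) • Ψ)).re =
      (innerProd κ ρ Φ Φ).re - 2 * t * Complex.normSq c := by
    intro t
    have h1 : innerProd κ ρ Ψ Φ = starRingEnd ℂ c :=
      (QuasiFree.innerProd_conj (potentialData κ ρ) Φ Ψ).symm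
    unfold innerProd at h1 hΨ0 hc ⊢
    rw [map_sub, map_sub, LinearMap.sub_apply, LinearMap.sub_apply, LinearMap.map_smulₛₗ,
      LinearMap.smul_apply, LinearMap.smul_apply, map_smul, map_smul, hΨ0, h1, ← hc]
    simp [Complex.normSq_apply]
    ring
  by_contra h
  have hpos := Complex.normSq_pos.2 h
  -- This `t` makes the value `-⟨Φ, Φ⟩ - 2`, which is negative.
  have h2 := innerProd_self_nonneg hκ ((physical κ ρ).sub_mem hΦ ((physical κ ρ).smul_mem
    ((((innerProd κ ρ Φ Φ).re + 1) / Complex.normSq c : ℝ) * starRingEnd ℂ c) hΨ))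
  have h3 := innerProd_self_nonneg hκ hΦ
  rw [hexp] at h2
  have h4 : 2 * (((innerProd κ ρ Φ Φ).re + 1) / Complex.normSq c) * Complex.normSq c =
      2 * ((innerProd κ ρ Φ Φ).re + 1) := by field_simp
  linarith

/-- By hermiticity `⟨FΨ, FΨ⟩` is the product of a physical vector with the null vector `Ψ`, hence
zero. -/
theorem fieldStrength_mem_nullVectors {κ ρ : ℝ} (hκ : κ ≠ 1) (ν μ : Fin 4) (h : Scalar)
    {Ψ : Domain κ ρ} (hΨ : Ψ ∈ nullVectors κ ρ) :
    fieldStrength κ ρ ν μ h Ψ ∈ nullVectors κ ρ := by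
  obtain ⟨hΨp, hΨ0⟩ := hΨ
  refine ⟨fieldStrength_mem_physical ν μ h hΨp, ?_⟩
  have hadj : innerProd κ ρ (fieldStrength κ ρ ν μ h Ψ) (fieldStrength κ ρ ν μ h Ψ) =
      innerProd κ ρ (fieldStrength κ ρ ν μ (conjScalar h) (fieldStrength κ ρ ν μ h Ψ)) Ψ := by
    rw [fieldStrength_eq, fieldStrength_eq, ← conjTest_fieldTest]
    exact QuasiFree.innerProd_field (potentialData κ ρ) _ _ _
  rw [hadj]
  exact innerProd_eq_zero_of_null hκ hΨp hΨ0
    (fieldStrength_mem_physical ν μ _ (fieldStrength_mem_physical ν μ h hΨp))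

theorem annihilator_divFieldTest {κ ρ : ℝ} (hκ : κ ≠ 1) (μ : Fin 4) (h : Scalar) {Ψ : Domain κ ρ}
    (hΨ : Ψ ∈ physical κ ρ) :
    QuasiFree.annihilator (potentialData κ ρ) (divFieldTest μ h) Ψ = 0 := by
  rw [QuasiFree.annihilator_congr (potentialData κ ρ)
    (g := gaugeTest (((κ : ℂ) - 1)⁻¹ • pd μ h))
    (LinearMap.ext fun g => twoPoint_divFieldTest_left hκ ρ μ h g)]
  exact mem_physical.1 hΨ _

/-- The annihilation part kills `Φ`; the creation part moves to the other side as an annihilation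
part and kills `Ψ`. -/
theorem innerProd_divFieldStrength {κ ρ : ℝ} (hκ : κ ≠ 1) {Ψ Φ : Domain κ ρ}
    (hΨ : Ψ ∈ physical κ ρ) (hΦ : Φ ∈ physical κ ρ) (μ : Fin 4) (h : Scalar) :
    innerProd κ ρ Ψ (divFieldStrength κ ρ μ h Φ) = 0 := by
  have hadj := QuasiFree.innerProd_field_sub_annihilator (potentialData κ ρ) (divFieldTest μ h) Ψ Φ
  have hconj : (potentialData κ ρ).conj (divFieldTest μ h) = divFieldTest μ (conjScalar h) :=
    conjTest_divFieldTest μ h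
  rw [annihilator_divFieldTest hκ μ h hΦ, hconj, annihilator_divFieldTest hκ μ _ hΨ, sub_zero,
    map_zero, LinearMap.zero_apply] at hadj
  rw [divFieldStrength_eq]
  exact hadj

end GuptaBleuler

end

theorem theorem5 (lam rho kappa : ℝ) (hlam : lam ≠ 1)
    (hkappa : kappa = lam / (1 - lam) ∨ kappa = -(lam / (1 - lam))) (hkappa1 : kappa ≠ 1) :
    -- `B⁺` is the positive frequency part of `B`
    (∀ h : Scalar, (∀ k, ft h (shell k (‖k‖ ^ 2)) = 0) →
      gaugeFieldPlus kappa rho h = gaugeField kappa rho h) ∧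
    (∀ h : Scalar, (∀ k, ft h (-shell k (‖k‖ ^ 2)) = 0) →
      gaugeFieldPlus kappa rho h = 0) ∧
    -- 1. the vacuum is a physical state
    vacuum kappa rho ∈ physical kappa rho ∧
    -- 2. the observable fields map the physical states to physical states
    (∀ (ν μ : Fin 4) (h : Scalar), ∀ Ψ ∈ physical kappa rho,
      fieldStrength kappa rho ν μ h Ψ ∈ physical kappa rho) ∧
    -- 3. the inner product is positive semidefinite on the physical states
    (∀ Ψ ∈ physical kappa rho,
      0 ≤ (innerProd kappa rho Ψ Ψ).re ∧ (innerProd kappa rho Ψ Ψ).im = 0) ∧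
    -- 4. the observable fields map the null vectors to null vectors
    (∀ (ν μ : Fin 4) (h : Scalar), ∀ Ψ ∈ nullVectors kappa rho,
      fieldStrength kappa rho ν μ h Ψ ∈ nullVectors kappa rho) ∧
    -- 5. the Maxwell equations hold weakly on the physical states
    (∀ Ψ ∈ physical kappa rho, ∀ Φ ∈ physical kappa rho, ∀ (μ : Fin 4) (h : Scalar),
      innerProd kappa rho Ψ (divFieldStrength kappa rho μ h Φ) = 0) := by
  exact ⟨fun h hh => gaugeFieldPlus_eq_gaugeField kappa rho hh,
    fun h hh => gaugeFieldPlus_eq_zero kappa rho hh, vacuum_mem_physical kappa rho,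
    fun ν μ h Ψ hΨ => fieldStrength_mem_physical ν μ h hΨ,
    fun Ψ hΨ => ⟨innerProd_self_nonneg hkappa1 hΨ, innerProd_self_im kappa rho Ψ⟩,
    fun ν μ h Ψ hΨ => fieldStrength_mem_nullVectors hkappa1 ν μ h hΨ,
    fun Ψ hΨ Φ hΦ μ h => innerProd_divFieldStrength hkappa1 hΨ hΦ μ h⟩
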